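/- Let $\Theta=t\frac{d}{dt}$. Let $$P=P(\Theta,t)=\Theta^n+p_{n-1}(t)\Theta^{n-1}+\cdots+p_1(t)\Theta+p_0(t),\qquad p_i\in\mathbb{C}(t),$$ be a Fuchsian operator on $\mathbb{P}^1$, i.e. every point of $\mathbb{P}^1$ is a non-singular or a regular singular point of $P$. For $\alpha\in\mathbb{C}$ let $$P(\alpha):=P(\Theta-\alpha,t)=(\Theta-\alpha)^n+p_{n-1}(t)(\Theta-\alpha)^{n-1}+\cdots+p_1(t)(\Theta-\alpha)+p_0(t).$$ Let $\Sigma\subset\mathbb{P}^1$ be the finite set consisting of $0$, $\infty$ and the poles of the $p_i$, and let $b\in\mathbb{P}^1\setminus\Sigma$. The monodromy group $\mathrm{Mon}(P)\subset\mathrm{GL}(V)$ is the group of automorphisms of the space $V$ of holomorphic solutions of $P=0$ near $b$ that are given by analytic continuation along loops in $\mathbb{P}^1\setminus\Sigma$ based at $b$; up to conjugation it does not depend on $b$. A Fuchsian operator is called symplectic if, in a suitable basis of the space of solutions, its monodromy group is a subgroup of $\mathrm{Sp}(4,\mathbb{Z})$ that is Zariski-dense in $\mathrm{Sp}(4,\mathbb{C})$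 (in particular the operator has order $4$). A monodromy group is called arithmetic if, in a suitable basis of the space of solutions, it is a subgroup of finite index of $\mathrm{Sp}(4,\mathbb{Z})$. Theorem. Let $P$ be a symplectic operator and let $\alpha\in\mathbb{C}$. Then $P(\alpha)$ is symplectic if and only if $2\alpha\in\mathbb{Z}$. Furthermore, if $2\alpha\in\mathbb{Z}$, then $\mathrm{Mon}(P)$ is arithmetic if and only if $\mathrm{Mon}(P(\alpha))$ is arithmetic. -/

import Mathlib

open Filter Topology

/-- A linear differential operator `P(Θ, t) = ∑ pᵢ(t) Θⁱ` with rational coefficients, where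
`Θ = t d/dt`. It is stored as the polynomial `P(X, t)` in `X = Θ` with coefficients in `ℂ(t)`,
the coefficients being written to the left of the powers of `Θ`. -/
abbrev ThetaOperator := Polynomial (RatFunc ℂ)

/-- The derivation `Θ = t d/dt`. -/
noncomputable def thetaDeriv (f : ℂ → ℂ) : ℂ → ℂ := fun t => t * deriv f t

/-- `r` has no pole at `t₀` (the denominator of a rational function is coprime to its
numerator). -/
def RatFunc.HolomorphicAt (r : RatFunc ℂ) (t₀ : ℂ) : Prop := r.denom.eval t₀ ≠ 0

namespace ThetaOperator

/-- The function `∑ pᵢ(t) (Θⁱ f)(t)`. -/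
noncomputable def apply (P : ThetaOperator) (f : ℂ → ℂ) (t : ℂ) : ℂ :=
  ∑ i ∈ Finset.range (P.natDegree + 1),
    (P.coeff i).eval (RingHom.id ℂ) t * (thetaDeriv^[i] f) t

/-- The shifted operator `P(α) = P(Θ - α, t)`. Constants commute with `Θ`, so that this is a
substitution in the polynomial `P(X, t)`. -/
noncomputable def shift (P : ThetaOperator) (α : ℂ) : ThetaOperator :=
  P.comp (Polynomial.X - Polynomial.C (RatFunc.C α))

/-- A Fuchsian operator on the projective line, in the form
`Θⁿ + pₙ₋₁(t) Θⁿ⁻¹ + ⋯ + p₀(t)`: every point is non-singular or a regular singular point. -/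
structure IsFuchsian (P : ThetaOperator) : Prop where
  monic : P.Monic
  /-- At `0` the coefficients of the `Θ`-form are holomorphic. -/
  at_zero : ∀ i, (P.coeff i).HolomorphicAt 0
  /-- At a point `t₀ ≠ 0` the coefficient `pᵢ` has a pole of order at most `n - i`; since
  `t` is a unit at `t₀`, this is the same condition as the one on the coefficients of
  the powers of `d/dt`. -/
  at_ne_zero : ∀ t₀ : ℂ, t₀ ≠ 0 → ∀ i ≤ P.natDegree,
    ((RatFunc.X - RatFunc.C t₀) ^ (P.natDegree - i) * P.coeff i).HolomorphicAt t₀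
  /-- At `∞` the local parameter is `s = t⁻¹`, with `s d/ds = -Θ`, so that the coefficients have
  to be holomorphic at `∞`. -/
  at_infinity : ∀ i, (P.coeff i).intDegree ≤ 0

/-- The points of `ℂ` removed from the projective line (together with `∞`): the origin and the
poles of the coefficients. Removing `0` or `∞` when it happens to be a non-singular point does
not change the monodromy group. -/
def singularSet (P : ThetaOperator) : Set ℂ :=
  {t | t = 0 ∨ ∃ i, ¬ (P.coeff i).HolomorphicAt t}

end ThetaOperator

theorem thetaDeriv_analyticAt {f : ℂ → ℂ} {b : ℂ} (hf : AnalyticAt ℂ f b) :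
    AnalyticAt ℂ (thetaDeriv f) b :=
  analyticAt_id.mul hf.deriv

theorem thetaDeriv_iterate_analyticAt {f : ℂ → ℂ} {b : ℂ} (hf : AnalyticAt ℂ f b) (i : ℕ) :
    AnalyticAt ℂ (thetaDeriv^[i] f) b := by
  induction i with
  | zero => simpa using hf
  | succ i ih =>
    rw [Function.iterate_succ_apply']
    exact thetaDeriv_analyticAt ih

theorem thetaDeriv_congr {f g : ℂ → ℂ} {b : ℂ} (h : f =ᶠ[𝓝 b] g) :
    thetaDeriv f =ᶠ[𝓝 b] thetaDeriv g := by
  filter_upwards [h.deriv] with t ht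
  simp [thetaDeriv, ht]

theorem thetaDeriv_iterate_linear {f g : ℂ → ℂ} {b : ℂ} (hf : AnalyticAt ℂ f b)
    (hg : AnalyticAt ℂ g b) (c : ℂ) (i : ℕ) :
    thetaDeriv^[i] (f + c • g) =ᶠ[𝓝 b] thetaDeriv^[i] f + c • thetaDeriv^[i] g := by
  induction i with
  | zero => exact EventuallyEq.rfl
  | succ i ih =>
    simp only [Function.iterate_succ_apply']
    refine (thetaDeriv_congr ih).trans ?_
    filter_upwards [(thetaDeriv_iterate_analyticAt hf i).eventually_analyticAt,
      (thetaDeriv_iterate_analyticAt hg i).eventually_analyticAt] with t h1 h2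
    have h3 := (h1.differentiableAt.hasDerivAt.add (h2.differentiableAt.hasDerivAt.const_smul c))
    simp only [thetaDeriv, Pi.add_apply, Pi.smul_apply, smul_eq_mul]
    rw [h3.deriv]
    simp only [smul_eq_mul]
    ring

theorem ThetaOperator.apply_linear (P : ThetaOperator) {f g : ℂ → ℂ} {b : ℂ}
    (hf : AnalyticAt ℂ f b) (hg : AnalyticAt ℂ g b) (c : ℂ) :
    ∀ᶠ t in 𝓝 b, P.apply (f + c • g) t = P.apply f t + c * P.apply g t := by
  have h : ∀ᶠ t in 𝓝 b, ∀ i ∈ Finset.range (P.natDegree + 1),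
      (thetaDeriv^[i] (f + c • g)) t = (thetaDeriv^[i] f + c • thetaDeriv^[i] g) t :=
    (Filter.eventually_all_finset _).2 fun i _ => thetaDeriv_iterate_linear hf hg c i
  filter_upwards [h] with t ht
  simp only [ThetaOperator.apply]
  rw [Finset.mul_sum, ← Finset.sum_add_distrib]
  refine Finset.sum_congr rfl fun i hi => ?_
  rw [ht i hi]
  simp only [Pi.add_apply, Pi.smul_apply, smul_eq_mul]
  ring

/-- The space `V` of holomorphic solutions of `P = 0` near `b`, as a space of germs at `b`. -/
def ThetaOperator.solutionSpace (P : ThetaOperator) (b : ℂ) :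
    Submodule ℂ (Germ (𝓝 b) ℂ) where
  carrier := {φ | ∃ y : ℂ → ℂ, AnalyticAt ℂ y b ∧ (∀ᶠ t in 𝓝 b, P.apply y t = 0) ∧
    φ = (y : Germ (𝓝 b) ℂ)}
  zero_mem' := by
    refine ⟨0, analyticAt_const, ?_, rfl⟩
    filter_upwards [P.apply_linear (analyticAt_const (v := (0 : ℂ)) (x := b))
      (analyticAt_const (v := (0 : ℂ)) (x := b)) (-1)] with t ht
    have h0 : ((fun _ => 0 : ℂ → ℂ) + (-1 : ℂ) • (fun _ => 0 : ℂ → ℂ)) = 0 := by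
      ext; simp
    rw [h0] at ht
    rw [ht]
    ring
  add_mem' := by
    rintro _ _ ⟨y, hy, hPy, rfl⟩ ⟨z, hz, hPz, rfl⟩
    refine ⟨y + z, hy.add hz, ?_, rfl⟩
    filter_upwards [P.apply_linear hy hz 1, hPy, hPz] with t h h1 h2
    rw [one_smul] at h
    rw [h, h1, h2]
    ring
  smul_mem' := by
    rintro c _ ⟨y, hy, hPy, rfl⟩
    refine ⟨c • y, hy.const_smul, ?_, rfl⟩
    filter_upwards [P.apply_linear hy hy (c - 1), hPy] with t h h1
    have h0 : y + (c - 1) • y = c • y := by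
      rw [sub_smul, one_smul]; abel
    rw [h0] at h
    rw [h, h1]
    ring

/-- The germ `ψ` at `c` is the analytic continuation of the germ `φ` at `b` along the path `γ`
from `b` to `c`: there is a family of germs `F s` of holomorphic functions at the points `γ s`,
each of them induced by one function for all parameters close to `s`, that starts with `φ` and
ends with `ψ`. -/
def IsContinuationAlong {b c : ℂ} (γ : Path b c) (φ : Germ (𝓝 b) ℂ) (ψ : Germ (𝓝 c) ℂ) : Prop :=
  ∃ F : unitInterval → ℂ → ℂ,
    (∀ s, AnalyticAt ℂ (F s) (γ s)) ∧
    (∀ s, ∀ᶠ s' in 𝓝 s, F s' =ᶠ[𝓝 (γ s')] F s) ∧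
    ((F 0 : ℂ → ℂ) : Germ (𝓝 b) ℂ) = φ ∧ ((F 1 : ℂ → ℂ) : Germ (𝓝 c) ℂ) = ψ

theorem IsContinuationAlong.refl {b : ℂ} {y : ℂ → ℂ} (hy : AnalyticAt ℂ y b) :
    IsContinuationAlong (Path.refl b) (y : Germ (𝓝 b) ℂ) (y : Germ (𝓝 b) ℂ) :=
  ⟨fun _ => y, fun _ => hy, fun _ => Eventually.of_forall fun _ => EventuallyEq.rfl, rfl, rfl⟩

theorem IsContinuationAlong.symm {b c : ℂ} {γ : Path b c} {φ : Germ (𝓝 b) ℂ} {ψ : Germ (𝓝 c) ℂ}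
    (h : IsContinuationAlong γ φ ψ) : IsContinuationAlong γ.symm ψ φ := by
  obtain ⟨F, h1, h2, h3, h4⟩ := h
  refine ⟨fun s => F (unitInterval.symm s), fun s => h1 _, fun s => ?_, by simpa using h4,
    by simpa using h3⟩
  exact (unitInterval.continuous_symm.tendsto s).eventually (h2 (unitInterval.symm s))

theorem IsContinuationAlong.trans {a b c : ℂ} {γ : Path a b} {γ' : Path b c}
    {φ : Germ (𝓝 a) ℂ} {ψ : Germ (𝓝 b) ℂ} {χ : Germ (𝓝 c) ℂ}
    (h : IsContinuationAlong γ φ ψ) (h' : IsContinuationAlong γ' ψ χ) :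
    IsContinuationAlong (γ.trans γ') φ χ := by
  obtain ⟨F, h1, h2, h3, h4⟩ := h
  obtain ⟨F', h1', h2', h3', h4'⟩ := h'
  have hglue : F 1 =ᶠ[𝓝 b] F' 0 := Germ.coe_eq.1 (h4.trans h3'.symm)
  let p : unitInterval → unitInterval := fun s => Set.projIcc 0 1 zero_le_one (2 * (s : ℝ))
  let q : unitInterval → unitInterval := fun s => Set.projIcc 0 1 zero_le_one (2 * (s : ℝ) - 1)
  have hp : Continuous p := continuous_projIcc.comp (by fun_prop)
  have hq : Continuous q := continuous_projIcc.comp (by fun_prop)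
  have hγp : ∀ s : unitInterval, (s : ℝ) ≤ 1 / 2 → (γ.trans γ') s = γ (p s) := by
    intro s hs
    rw [Path.trans_apply, dif_pos hs]
    congr 1
    exact (Set.projIcc_of_mem zero_le_one _).symm
  have hγq : ∀ s : unitInterval, ¬ (s : ℝ) ≤ 1 / 2 → (γ.trans γ') s = γ' (q s) := by
    intro s hs
    rw [Path.trans_apply, dif_neg hs]
    congr 1
    exact (Set.projIcc_of_mem zero_le_one _).symm
  have hFp := fun s => (hp.tendsto s).eventually (h2 (p s))
  have hFq := fun s => (hq.tendsto s).eventually (h2' (q s))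
  refine ⟨fun s => if (s : ℝ) ≤ 1 / 2 then F (p s) else F' (q s), ?_, ?_, ?_, ?_⟩
  · intro s
    by_cases hs : (s : ℝ) ≤ 1 / 2
    · simp only [if_pos hs, hγp s hs]; exact h1 _
    · simp only [if_neg hs, hγq s hs]; exact h1' _
  · intro s
    rcases lt_trichotomy (s : ℝ) (1 / 2) with hs | hs | hs
    · have hev : ∀ᶠ s' : unitInterval in 𝓝 s, (s' : ℝ) < 1 / 2 :=
        continuous_subtype_val.continuousAt.eventually (gt_mem_nhds hs)
      filter_upwards [hev, hFp s] with s' hs' hF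
      rw [if_pos hs'.le, if_pos hs.le, hγp s' hs'.le]
      exact hF
    · have hp1 : p s = 1 := by
        apply Subtype.ext
        simp only [p, hs]
        norm_num [Set.projIcc]
      have hq0 : q s = 0 := by
        apply Subtype.ext
        simp only [q, hs]
        norm_num [Set.projIcc]
      have hb : Tendsto (fun s' => γ' (q s')) (𝓝 s) (𝓝 b) := by
        have h5 := (γ'.continuous.comp hq).tendsto s
        simp only [Function.comp_apply, hq0, γ'.source] at h5
        exact h5
      have hev := hb.eventually hglue.eventuallyEq_nhds
      filter_upwards [hFp s, hFq s, hev] with s' hF hF' hG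
      rw [if_pos hs.le, hp1]
      rw [hp1] at hF
      rw [hq0] at hF'
      by_cases hs' : (s' : ℝ) ≤ 1 / 2
      · rw [if_pos hs', hγp s' hs']; exact hF
      · rw [if_neg hs', hγq s' hs']; exact hF'.trans hG.symm
    · have hev : ∀ᶠ s' : unitInterval in 𝓝 s, 1 / 2 < (s' : ℝ) :=
        continuous_subtype_val.continuousAt.eventually (lt_mem_nhds hs)
      filter_upwards [hev, hFq s] with s' hs' hF
      rw [if_neg (not_le.2 hs'), if_neg (not_le.2 hs), hγq s' (not_le.2 hs')]
      exact hF
  · have : p 0 = 0 := by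
      apply Subtype.ext; simp [p, Set.projIcc]
    simp [this, h3]
  · have : q 1 = 1 := by
      apply Subtype.ext; norm_num [q, Set.projIcc]
    have h1 : ¬ (((1 : unitInterval) : ℝ) ≤ 1 / 2) := by norm_num
    simp only [h1, if_false, this, h4']

/-- The monodromy group of `P` with base point `b`: the automorphisms of the space of solutions
near `b` that are given by analytic continuation along a loop at `b` that avoids the
singular points. -/
def ThetaOperator.monodromyGroup (P : ThetaOperator) (b : ℂ) (hb : b ∉ P.singularSet) :
    Subgroup (P.solutionSpace b ≃ₗ[ℂ] P.solutionSpace b) where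
  carrier := {g | ∃ γ : Path b b, (∀ s, γ s ∉ P.singularSet) ∧
    ∀ y : P.solutionSpace b, IsContinuationAlong γ (y : Germ (𝓝 b) ℂ) (g y : Germ (𝓝 b) ℂ)}
  one_mem' := by
    refine ⟨Path.refl b, fun _ => hb, ?_⟩
    rintro ⟨_, y, hy, _, rfl⟩
    exact IsContinuationAlong.refl hy
  mul_mem' := by
    rintro g h ⟨γ, hγ, hg⟩ ⟨δ, hδ, hh⟩
    refine ⟨δ.trans γ, fun s => ?_, fun y => (hh y).trans (hg (h y))⟩
    rw [Path.trans_apply]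
    split_ifs
    · exact hδ _
    · exact hγ _
  inv_mem' := by
    rintro g ⟨γ, hγ, hg⟩
    refine ⟨γ.symm, fun s => hγ _, fun y => ?_⟩
    have h := (hg (g.symm y)).symm
    rw [LinearEquiv.apply_symm_apply] at h
    exact h

/-- The group `Sp(4, ℤ)`. -/
abbrev SpFourInt := Matrix.symplecticGroup (Fin 2) ℤ

/-- The monodromy group of `P` with base point `b` is conjugate to the subgroup `G` of
`Sp(4, ℤ)`: in a suitable basis of the space of solutions its elements are exactly the
matrices in `G`. -/
def ThetaOperator.MonodromyConjugateTo (P : ThetaOperator) (b : ℂ) (hb : b ∉ P.singularSet)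
    (G : Subgroup SpFourInt) : Prop :=
  ∃ B : Module.Basis (Fin 2 ⊕ Fin 2) ℂ (P.solutionSpace b),
    (fun g : P.solutionSpace b ≃ₗ[ℂ] P.solutionSpace b =>
        LinearMap.toMatrix B B (g : P.solutionSpace b →ₗ[ℂ] P.solutionSpace b)) ''
      (P.monodromyGroup b hb : Set (P.solutionSpace b ≃ₗ[ℂ] P.solutionSpace b)) =
    (fun A : SpFourInt => (A : Matrix (Fin 2 ⊕ Fin 2) (Fin 2 ⊕ Fin 2) ℤ).map
        (Int.cast : ℤ → ℂ)) '' (G : Set SpFourInt)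

/-- `G` is Zariski-dense in `Sp(4, ℂ)`: a polynomial in the matrix entries that vanishes on `G`
vanishes on `Sp(4, ℂ)`. -/
def IsZariskiDense (G : Subgroup SpFourInt) : Prop :=
  ∀ f : MvPolynomial ((Fin 2 ⊕ Fin 2) × (Fin 2 ⊕ Fin 2)) ℂ,
    (∀ A ∈ G, MvPolynomial.eval
      (fun ij => (((A : Matrix (Fin 2 ⊕ Fin 2) (Fin 2 ⊕ Fin 2) ℤ) ij.1 ij.2 : ℤ) : ℂ)) f = 0) →
    ∀ A ∈ Matrix.symplecticGroup (Fin 2) ℂ, MvPolynomial.eval (fun ij => A ij.1 ij.2) f = 0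

/-- A Fuchsian operator is symplectic if its monodromy group is conjugate to a Zariski-dense
subgroup of `Sp(4, ℤ)`. The monodromy groups at any two base points are conjugate, so that the
choice of the base point is immaterial. -/
def ThetaOperator.IsSymplectic (P : ThetaOperator) : Prop :=
  P.IsFuchsian ∧ ∀ (b : ℂ) (hb : b ∉ P.singularSet),
    ∃ G : Subgroup SpFourInt, P.MonodromyConjugateTo b hb G ∧ IsZariskiDense G

/-- The monodromy group of `P` is arithmetic: it is conjugate to a subgroup of finite index
of `Sp(4, ℤ)`. -/
def ThetaOperator.HasArithmeticMonodromy (P : ThetaOperator) : Prop :=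
  ∀ (b : ℂ) (hb : b ∉ P.singularSet),
    ∃ G : Subgroup SpFourInt, P.MonodromyConjugateTo b hb G ∧ G.FiniteIndex

/-! Multiplication by a branch of `t ^ α` intertwines `Θ` with `Θ - α`, so it carries the solutions
of `P` onto those of `P(α)`. Along a loop with winding number `n` around the origin the branch is
multiplied by `exp (2πi n α)`, and the monodromy of `P(α)` is that of `P` times this scalar.

If `2α` is an integer, the scalars are `±1`. As `-1` lies in `Sp(4, ℤ)`, the two groups agree up to
signs of individual elements (`MonodromyConjugateTo.shift`). Finite index survives such sign changes
by counting cosets, and Zariski density because `f(A) f(-A) = 0` on `Sp(4, ℂ)` forces `f = 0` there.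

Conversely, let both operators be symplectic. The symplectic form of `P(α)`, carried back to the
solutions of `P`, is preserved up to scalars by the monodromy of `P`, hence by density by `Sp(4,
ℂ)`, hence is a multiple of the standard form (`exists_eq_smul_J`). The monodromy of `P` therefore
preserves it exactly, so every scalar that occurs has square `1`. A small circle around the origin
has the scalar `exp (2πiα)` (`exists_monodromy_around_zero`), so `2α` is an integer. -/

/-! ### Rational functions holomorphic at a point or at infinity -/

namespace RatFunc.HolomorphicAt

variable {r s : RatFunc ℂ} {t₀ : ℂ}

theorem add (hr : r.HolomorphicAt t₀) (hs : s.HolomorphicAt t₀) : (r + s).HolomorphicAt t₀ := by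
  intro h
  have := Polynomial.eval_eq_zero_of_dvd_of_eval_eq_zero (RatFunc.denom_add_dvd r s) h
  rw [Polynomial.eval_mul] at this
  exact mul_ne_zero hr hs this

theorem mul (hr : r.HolomorphicAt t₀) (hs : s.HolomorphicAt t₀) : (r * s).HolomorphicAt t₀ := by
  intro h
  have := Polynomial.eval_eq_zero_of_dvd_of_eval_eq_zero (RatFunc.denom_mul_dvd r s) h
  rw [Polynomial.eval_mul] at this
  exact mul_ne_zero hr hs this

theorem const (c t₀ : ℂ) : (RatFunc.C c).HolomorphicAt t₀ := by
  simp [RatFunc.HolomorphicAt]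

theorem zero (t₀ : ℂ) : (0 : RatFunc ℂ).HolomorphicAt t₀ := by
  simp [RatFunc.HolomorphicAt]

theorem X_sub_const_pow (c : ℂ) (t₀ : ℂ) (n : ℕ) :
    ((RatFunc.X - RatFunc.C c) ^ n).HolomorphicAt t₀ := by
  have h : (RatFunc.X - RatFunc.C c) ^ n =
      algebraMap (Polynomial ℂ) (RatFunc ℂ) ((Polynomial.X - Polynomial.C c) ^ n) := by
    simp
  rw [h, RatFunc.HolomorphicAt, RatFunc.denom_algebraMap]
  simp

theorem sum {ι : Type*} {S : Finset ι} {f : ι → RatFunc ℂ}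
    (h : ∀ i ∈ S, (f i).HolomorphicAt t₀) : (∑ i ∈ S, f i).HolomorphicAt t₀ := by
  classical
  induction S using Finset.induction_on with
  | empty => simpa using zero t₀
  | insert a S ha ih =>
    rw [Finset.sum_insert ha]
    exact (h a (by simp)).add (ih fun i hi => h i (by simp [hi]))

theorem eval_sum {ι : Type*} {S : Finset ι} {f : ι → RatFunc ℂ}
    (h : ∀ i ∈ S, (f i).HolomorphicAt t₀) :
    (∑ i ∈ S, f i).eval (RingHom.id ℂ) t₀ = ∑ i ∈ S, (f i).eval (RingHom.id ℂ) t₀ := by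
  classical
  induction S using Finset.induction_on with
  | empty => simp
  | insert a S ha ih =>
    have h' : ∀ i ∈ S, (f i).HolomorphicAt t₀ := fun i hi => h i (by simp [hi])
    rw [Finset.sum_insert ha, Finset.sum_insert ha, RatFunc.eval_add _ _ (h a (by simp)) (sum h'),
      ih h']

theorem eval_mul_const (hr : r.HolomorphicAt t₀) (c : ℂ) :
    (r * RatFunc.C c).eval (RingHom.id ℂ) t₀ = r.eval (RingHom.id ℂ) t₀ * c := by
  rw [RatFunc.eval_mul _ _ hr (const c t₀), RatFunc.eval_C]
  rfl

theorem eventually (hr : r.HolomorphicAt t₀) : ∀ᶠ t in 𝓝 t₀, r.HolomorphicAt t :=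
  r.denom.continuous.continuousAt.eventually_ne hr

end RatFunc.HolomorphicAt

theorem RatFunc.intDegree_sum_le_zero {ι : Type*} {S : Finset ι} {f : ι → RatFunc ℂ}
    (h : ∀ i ∈ S, (f i).intDegree ≤ 0) : (∑ i ∈ S, f i).intDegree ≤ 0 := by
  classical
  induction S using Finset.induction_on with
  | empty => simp
  | insert a S ha ih =>
    rw [Finset.sum_insert ha]
    have h1 := h a (by simp)
    have h2 := ih fun i hi => h i (by simp [hi])
    by_cases hy : ∑ i ∈ S, f i = 0
    · simpa [hy] using h1
    by_cases hxy : f a + ∑ i ∈ S, f i = 0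
    · simp [hxy]
    · exact (RatFunc.intDegree_add_le hy hxy).trans (max_le h1 h2)

theorem RatFunc.intDegree_mul_const_le {r : RatFunc ℂ} (h : r.intDegree ≤ 0) (c : ℂ) :
    (r * RatFunc.C c).intDegree ≤ 0 := by
  by_cases hr : r = 0
  · simp [hr]
  by_cases hc : c = 0
  · simp [hc]
  rw [RatFunc.intDegree_mul hr (by simpa using hc), RatFunc.intDegree_C]
  simpa using h

/-! ### The shifted operator: coefficients, Fuchsian condition, singular set -/

namespace ThetaOperator

variable {P : ThetaOperator} {α : ℂ}

theorem natDegree_shift (P : ThetaOperator) (α : ℂ) : (P.shift α).natDegree = P.natDegree := by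
  rw [shift, Polynomial.natDegree_comp, Polynomial.natDegree_X_sub_C, mul_one]

theorem shift_shift (P : ThetaOperator) (α β : ℂ) : (P.shift α).shift β = P.shift (α + β) := by
  simp only [shift, Polynomial.comp_assoc, Polynomial.sub_comp, Polynomial.X_comp,
    Polynomial.C_comp, map_add]
  congr 1
  ring

theorem shift_zero (P : ThetaOperator) : P.shift 0 = P := by
  simp [shift]

theorem shift_neg_shift (P : ThetaOperator) (α : ℂ) : (P.shift α).shift (-α) = P := by
  rw [shift_shift, add_neg_cancel, shift_zero]

/-- Binomial expansion of `(X - α) ^ j`. For `i > j` the exponent `j - i` truncates to `0`, but the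
binomial coefficient vanishes. -/
theorem coeff_shift (P : ThetaOperator) (α : ℂ) (i : ℕ) :
    (P.shift α).coeff i = ∑ j ∈ Finset.range (P.natDegree + 1),
      P.coeff j * RatFunc.C ((-α) ^ (j - i) * (j.choose i : ℂ)) := by
  rw [shift, Polynomial.comp, Polynomial.eval₂_eq_sum_range, Polynomial.finsetSum_coeff]
  refine Finset.sum_congr rfl fun j _ => ?_
  rw [Polynomial.coeff_C_mul, sub_eq_add_neg, ← Polynomial.C_neg, Polynomial.coeff_X_add_C_pow]
  simp

theorem holomorphicAt_coeff_shift {t₀ : ℂ} (h : ∀ i, (P.coeff i).HolomorphicAt t₀) (i : ℕ) :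
    ((P.shift α).coeff i).HolomorphicAt t₀ := by
  rw [coeff_shift]
  exact RatFunc.HolomorphicAt.sum fun j _ => (h j).mul (.const _ _)

theorem IsFuchsian.shift (h : P.IsFuchsian) (α : ℂ) : (P.shift α).IsFuchsian where
  monic := h.monic.comp (Polynomial.monic_X_sub_C _) (by simp)
  at_zero := holomorphicAt_coeff_shift h.at_zero
  at_ne_zero t₀ ht₀ i _ := by
    rw [natDegree_shift, coeff_shift, Finset.mul_sum]
    refine RatFunc.HolomorphicAt.sum fun j hj => ?_
    rw [Finset.mem_range, Nat.lt_succ_iff] at hj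
    rw [← mul_assoc]
    by_cases hij : i ≤ j
    · refine RatFunc.HolomorphicAt.mul ?_ (.const _ _)
      -- The pole of `pⱼ` has order at most `n - j`, which is at most `n - i`; the factor `(t - t₀)
      -- ^ (j - i)` is left over.
      have : P.natDegree - i = (j - i) + (P.natDegree - j) := by omega
      rw [this, pow_add, mul_assoc]
      exact (RatFunc.HolomorphicAt.X_sub_const_pow _ _ _).mul (h.at_ne_zero t₀ ht₀ j hj)
    · rw [Nat.choose_eq_zero_of_lt (not_le.1 hij)]
      simpa using RatFunc.HolomorphicAt.zero t₀
  at_infinity i := by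
    rw [coeff_shift]
    exact RatFunc.intDegree_sum_le_zero fun j _ =>
      RatFunc.intDegree_mul_const_le (h.at_infinity j) _

theorem notMem_singularSet {t : ℂ} :
    t ∉ P.singularSet ↔ t ≠ 0 ∧ ∀ i, (P.coeff i).HolomorphicAt t := by
  simp [singularSet]

theorem notMem_singularSet_shift {t : ℂ} (h : t ∉ P.singularSet) (α : ℂ) :
    t ∉ (P.shift α).singularSet := by
  rw [notMem_singularSet] at h ⊢
  exact ⟨h.1, holomorphicAt_coeff_shift h.2⟩

theorem notMem_singularSet_of_shift {t : ℂ} (h : t ∉ (P.shift α).singularSet) :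
    t ∉ P.singularSet := by
  simpa only [shift_neg_shift] using notMem_singularSet_shift h (-α)

theorem eventually_forall_holomorphicAt {t₀ : ℂ} (h : ∀ i, (P.coeff i).HolomorphicAt t₀) :
    ∀ᶠ t in 𝓝 t₀, ∀ i, (P.coeff i).HolomorphicAt t := by
  have h1 : ∀ᶠ t in 𝓝 t₀, ∀ i ∈ Finset.range (P.natDegree + 1), (P.coeff i).HolomorphicAt t :=
    (Filter.eventually_all_finset _).2 fun i _ => (h i).eventually
  filter_upwards [h1] with t ht i
  by_cases hi : i ∈ Finset.range (P.natDegree + 1)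
  · exact ht i hi
  · rw [Polynomial.coeff_eq_zero_of_natDegree_lt (by simp only [Finset.mem_range] at hi; omega)]
    exact .zero t

theorem eventually_notMem_singularSet {t₀ : ℂ} (h : t₀ ∉ P.singularSet) :
    ∀ᶠ t in 𝓝 t₀, t ∉ P.singularSet := by
  rw [notMem_singularSet] at h
  filter_upwards [eventually_forall_holomorphicAt h.2, isOpen_ne.mem_nhds h.1] with t h1 h2
  exact notMem_singularSet.2 ⟨h2, h1⟩

end ThetaOperator

/-! ### Conjugation of the operator by a solution of `Θ u = α u` -/

theorem thetaDeriv_iterate_congr {f g : ℂ → ℂ} {b : ℂ} (h : f =ᶠ[𝓝 b] g) (i : ℕ) :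
    thetaDeriv^[i] f =ᶠ[𝓝 b] thetaDeriv^[i] g := by
  induction i with
  | zero => exact h
  | succ i ih =>
    simp only [Function.iterate_succ_apply']
    exact thetaDeriv_congr ih

/-- A binomial formula for sequences of sequences, each of which arises from the preceding one
by the operator `E - α`, where `E` is the shift of a sequence. -/
theorem sum_choose_mul_eq_of_recursion {α : ℂ} {a : ℕ → ℕ → ℂ}
    (h : ∀ k i, a (k + 1) i = a k (i + 1) - α * a k i) (j : ℕ) :
    ∑ i ∈ Finset.range (j + 1), (-α) ^ (j - i) * (j.choose i : ℂ) * a 0 i = a j 0 := by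
  let E : Module.End ℂ (ℕ → ℂ) := LinearMap.funLeft ℂ ℂ Nat.succ
  have hE : ∀ i x, (E ^ i) x 0 = x i := by
    intro i
    induction i with
    | zero => intro x; rfl
    | succ i ih =>
      intro x
      rw [pow_succ, Module.End.mul_apply, ih]
      rfl
  -- The scalar `-α` commutes with `E`, so the binomial theorem applies to this power; evaluation at
  -- `0` then turns `E ^ i` into the `i`-th entry.
  have ha : ∀ k, a k = ((E + algebraMap ℂ _ (-α)) ^ k) (a 0) := by
    intro k
    induction k with
    | zero => rfl
    | succ k ih =>
      rw [pow_succ', Module.End.mul_apply, ← ih]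
      ext i
      rw [h k i]
      simp [E, Module.algebraMap_end_apply, LinearMap.funLeft_apply, sub_eq_add_neg]
  rw [ha j, (Algebra.commute_algebraMap_right (-α) E).add_pow]
  simp only [LinearMap.sum_apply, Finset.sum_apply]
  refine Finset.sum_congr rfl fun i _ => ?_
  rw [← map_pow, ← map_natCast (algebraMap ℂ (Module.End ℂ (ℕ → ℂ))), mul_assoc (E ^ i),
    ← map_mul, ← Algebra.commutes, Module.End.mul_apply, Module.algebraMap_end_apply, Pi.smul_apply, hE,
    smul_eq_mul]

/-- By the Leibniz rule `(Θ - α)(u z) = u Θ z`, and iteration gives `(Θ - α)ʲ (u y) = u Θʲ y`. The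
left side is the expanded form of `(Θ - α)ʲ`. -/
theorem sum_thetaDeriv_iterate_mul {α : ℂ} {u y : ℂ → ℂ} {t : ℂ} (hu : AnalyticAt ℂ u t)
    (hy : AnalyticAt ℂ y t) (hα : thetaDeriv u =ᶠ[𝓝 t] α • u) (j : ℕ) :
    ∑ i ∈ Finset.range (j + 1), (-α) ^ (j - i) * (j.choose i : ℂ) * (thetaDeriv^[i] (u * y)) t =
      u t * (thetaDeriv^[j] y) t := by
  refine sum_choose_mul_eq_of_recursion
    (a := fun k i => (thetaDeriv^[i] (u * thetaDeriv^[k] y)) t) (fun k i => ?_) j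
  have hz := thetaDeriv_iterate_analyticAt hy k
  set z := thetaDeriv^[k] y
  have h1 : u * thetaDeriv^[k + 1] y =ᶠ[𝓝 t] thetaDeriv (u * z) + (-α) • (u * z) := by
    rw [Function.iterate_succ_apply']
    filter_upwards [hα, hu.eventually_analyticAt, hz.eventually_analyticAt] with s hs hus hzs
    have h2 := hus.differentiableAt.hasDerivAt.mul hzs.differentiableAt.hasDerivAt
    simp only [thetaDeriv, Pi.smul_apply, smul_eq_mul, Pi.mul_apply, Pi.add_apply] at hs ⊢
    rw [h2.deriv]
    linear_combination (-z s) * hs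
  have h2 := (thetaDeriv_iterate_congr h1 i).trans
    (thetaDeriv_iterate_linear (thetaDeriv_analyticAt (hu.mul hz)) (hu.mul hz) (-α) i)
  rw [h2.eq_of_nhds, Function.iterate_succ_apply]
  simp [sub_eq_add_neg]

namespace ThetaOperator

theorem apply_shift_mul {P : ThetaOperator} {α : ℂ} {u y : ℂ → ℂ} {t : ℂ}
    (ht : ∀ i, (P.coeff i).HolomorphicAt t) (hu : AnalyticAt ℂ u t) (hy : AnalyticAt ℂ y t)
    (hα : thetaDeriv u =ᶠ[𝓝 t] α • u) :
    (P.shift α).apply (u * y) t = u t * P.apply y t := by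
  rw [apply, apply, natDegree_shift, Finset.mul_sum]
  have h1 : ∀ i, ((P.shift α).coeff i).eval (RingHom.id ℂ) t =
      ∑ j ∈ Finset.range (P.natDegree + 1),
        (P.coeff j).eval (RingHom.id ℂ) t * ((-α) ^ (j - i) * (j.choose i : ℂ)) := by
    intro i
    rw [coeff_shift, RatFunc.HolomorphicAt.eval_sum fun j _ => (ht j).mul (.const _ _)]
    exact Finset.sum_congr rfl fun j _ => (ht j).eval_mul_const _
  simp only [h1, Finset.sum_mul]
  rw [Finset.sum_comm]
  refine Finset.sum_congr rfl fun j hj => ?_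
  rw [mul_left_comm, ← sum_thetaDeriv_iterate_mul hu hy hα j, Finset.mul_sum]
  symm
  -- The inner sum stops at `j` on one side and at the degree on the other; the extra terms `i > j`
  -- contain a vanishing binomial coefficient.
  refine Finset.sum_subset_zero_on_sdiff
    (Finset.range_mono (by simpa using hj)) (fun i hi => ?_)
    fun i _ => by ring
  have : j < i := by
    have := (Finset.mem_sdiff.1 hi).2
    simp only [Finset.mem_range] at this
    omega
  simp [Nat.choose_eq_zero_of_lt this]

end ThetaOperator

/-! ### Branches of `t ^ α` and their continuation -/

/-- The branch of the logarithm near `exp w` with value `w` at `exp w`. -/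
noncomputable def logBranch (w t : ℂ) : ℂ := Complex.log (t * Complex.exp (-w)) + w

/-- The branch `exp (α log t)` of `t ^ α` near `exp w`. -/
noncomputable def powBranch (α w t : ℂ) : ℂ := Complex.exp (α * logBranch w t)

theorem logBranch_hasDerivAt {w t : ℂ} (h : t * Complex.exp (-w) ∈ Complex.slitPlane) :
    HasDerivAt (logBranch w) t⁻¹ t := by
  have h1 : HasDerivAt (fun t : ℂ => t * Complex.exp (-w)) (Complex.exp (-w)) t := by
    simpa using (hasDerivAt_id t).mul_const (Complex.exp (-w))
  have h2 := (h1.clog h).add_const w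
  have h3 : Complex.exp (-w) / (t * Complex.exp (-w)) = t⁻¹ := by
    rw [div_eq_mul_inv, mul_inv_rev, mul_inv_cancel_left₀ (Complex.exp_ne_zero _)]
  exact h3 ▸ h2

theorem powBranch_hasDerivAt (α : ℂ) {w t : ℂ}
    (h : t * Complex.exp (-w) ∈ Complex.slitPlane) :
    HasDerivAt (powBranch α w) (powBranch α w t * (α * t⁻¹)) t :=
  ((logBranch_hasDerivAt h).const_mul α).cexp

theorem powBranch_analyticAt (α : ℂ) {w t : ℂ}
    (h : t * Complex.exp (-w) ∈ Complex.slitPlane) : AnalyticAt ℂ (powBranch α w) t := by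
  have h1 : AnalyticAt ℂ (fun t : ℂ => t * Complex.exp (-w)) t := by fun_prop
  exact (analyticAt_const.mul ((h1.clog h).add analyticAt_const)).cexp

theorem eventually_mem_slitPlane {w t : ℂ} (h : t * Complex.exp (-w) ∈ Complex.slitPlane) :
    ∀ᶠ s in 𝓝 t, s * Complex.exp (-w) ∈ Complex.slitPlane :=
  (continuous_id.mul continuous_const).continuousAt.eventually
    (Complex.isOpen_slitPlane.mem_nhds h)

theorem thetaDeriv_powBranch (α : ℂ) {w t : ℂ}
    (h : t * Complex.exp (-w) ∈ Complex.slitPlane) :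
    thetaDeriv (powBranch α w) =ᶠ[𝓝 t] α • powBranch α w := by
  filter_upwards [eventually_mem_slitPlane h] with s hs
  have hs0 : s ≠ 0 := by
    rintro rfl
    simp at hs
  rw [thetaDeriv, (powBranch_hasDerivAt α hs).deriv, Pi.smul_apply, smul_eq_mul]
  field_simp

theorem exp_mul_exp_neg_mem_slitPlane (w : ℂ) :
    Complex.exp w * Complex.exp (-w) ∈ Complex.slitPlane := by
  rw [← Complex.exp_add]
  simp

theorem powBranch_neg_mul (α w : ℂ) : powBranch (-α) w * powBranch α w = 1 := by
  ext t
  simp [powBranch, ← Complex.exp_add]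

theorem powBranch_add_two_pi (α w : ℂ) (n : ℤ) :
    powBranch α (w + n * (2 * Real.pi * Complex.I)) =
      Complex.exp (n * (2 * Real.pi * Complex.I) * α) • powBranch α w := by
  ext t
  have h : Complex.exp (-(w + n * (2 * Real.pi * Complex.I))) = Complex.exp (-w) := by
    rw [Complex.exp_eq_exp_iff_exists_int]
    exact ⟨-n, by push_cast; ring⟩
  simp only [powBranch, logBranch, h, Pi.smul_apply, smul_eq_mul, ← Complex.exp_add]
  congr 1
  ring

/-- Both `t e^{-w'}` and `e^{w' - w}` have argument in `(-π/2, π/2)`, so the principal logarithm is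
additive on their product. -/
theorem logBranch_eq_logBranch {w w' t : ℂ} (h : |(w' - w).im| < Real.pi / 2)
    (ht : 0 < (t * Complex.exp (-w')).re) : logBranch w' t = logBranch w t := by
  have h1 := abs_lt.1 h
  have hpi := Real.pi_pos
  have hlog : Complex.log (Complex.exp (w' - w)) = w' - w :=
    Complex.log_exp (by linarith) (by linarith)
  have harg : (Complex.exp (w' - w)).arg = (w' - w).im := by rw [← Complex.log_im, hlog]
  have h2 := abs_lt.1 (Complex.abs_arg_lt_pi_div_two_iff.2 (Or.inl ht))
  have h3 : t * Complex.exp (-w) = (t * Complex.exp (-w')) * Complex.exp (w' - w) := by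
    rw [mul_assoc, ← Complex.exp_add]
    congr 2
    ring
  have h0 : t * Complex.exp (-w') ≠ 0 := by
    intro h0
    simp [h0] at ht
  rw [logBranch, logBranch, h3, Complex.log_mul h0 (Complex.exp_ne_zero _)
    ⟨by rw [harg]; linarith, by rw [harg]; linarith⟩, hlog]
  ring

theorem powBranch_eventuallyEq (α : ℂ) {w w' : ℂ} (h : |(w' - w).im| < Real.pi / 2) :
    powBranch α w' =ᶠ[𝓝 (Complex.exp w')] powBranch α w := by
  have hc : ContinuousAt (fun t : ℂ => (t * Complex.exp (-w')).re) (Complex.exp w') := by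
    fun_prop
  have h0 : (0 : ℝ) < (Complex.exp w' * Complex.exp (-w')).re := by
    rw [← Complex.exp_add]
    simp
  filter_upwards [hc.eventually (lt_mem_nhds h0)] with t ht
  rw [powBranch, powBranch, logBranch_eq_logBranch h ht]

/-- The branches are parametrised by logarithms of the base point, so a continuous logarithm along
the path is itself the required family of germs. -/
theorem powBranch_isContinuationAlong (α : ℂ) {b c : ℂ} (γ : Path b c) {l : unitInterval → ℂ}
    (hl : Continuous l) (hγ : ∀ s, Complex.exp (l s) = γ s) :
    IsContinuationAlong γ (powBranch α (l 0) : Germ (𝓝 b) ℂ) (powBranch α (l 1)) := by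
  refine ⟨fun s => powBranch α (l s), fun s => ?_, fun s => ?_, rfl, rfl⟩
  · rw [← hγ]
    exact powBranch_analyticAt α (exp_mul_exp_neg_mem_slitPlane _)
  · have hc : ContinuousAt (fun s' => |(l s' - l s).im|) s := by fun_prop
    have h0 : |(l s - l s).im| < Real.pi / 2 := by
      simpa using Real.pi_pos
    filter_upwards [hc.eventually (gt_mem_nhds h0)] with s' hs'
    rw [← hγ]
    exact powBranch_eventuallyEq α hs'

theorem exists_lift_exp {b c w : ℂ} (γ : Path b c) (hγ : ∀ s, γ s ≠ 0) (hw : Complex.exp w = b) :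
    ∃ l : unitInterval → ℂ, Continuous l ∧ (∀ s, Complex.exp (l s) = γ s) ∧ l 0 = w := by
  let γ' : C(unitInterval, {z : ℂ // z ≠ 0}) :=
    ⟨fun s => ⟨γ s, hγ s⟩, γ.continuous.subtype_mk _⟩
  obtain ⟨Γ, h1, h2⟩ := Complex.isCoveringMap_exp.exists_path_lifts γ' w
    (Subtype.ext (by simp [γ', hw]))
  exact ⟨Γ, Γ.continuous, fun s => congrArg Subtype.val (congrFun h1 s), h2⟩

/-- Continuation along a loop multiplies a branch of `t ^ α` by `exp (2πi n α)`, where `n` is the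
winding number of the loop around the origin. -/
theorem exists_powBranch_isContinuationAlong_loop {b w : ℂ} (α : ℂ) (γ : Path b b)
    (hγ : ∀ s, γ s ≠ 0) (hw : Complex.exp w = b) :
    ∃ n : ℤ, IsContinuationAlong γ (powBranch α w : Germ (𝓝 b) ℂ)
      (Complex.exp (n * (2 * Real.pi * Complex.I) * α) • powBranch α w : ℂ → ℂ) := by
  obtain ⟨l, h1, h2, h3⟩ := exists_lift_exp γ hγ hw
  have h4 : Complex.exp (l 1) = Complex.exp w := by rw [h2, hw, γ.target]
  obtain ⟨n, hn⟩ := Complex.exp_eq_exp_iff_exists_int.1 h4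
  refine ⟨n, ?_⟩
  rw [← powBranch_add_two_pi, ← hn, ← h3]
  exact powBranch_isContinuationAlong α γ h1 h2

/-! ### Comparison of the monodromy groups of `P` and `P(α)` -/

theorem germ_smul_mul {b : ℂ} (c : ℂ) (φ ψ : Germ (𝓝 b) ℂ) : (c • φ) * ψ = c • (φ * ψ) :=
  Germ.inductionOn₂ φ ψ fun f g => congrArg _ (smul_mul_assoc c f g)

theorem germ_mul_smul {b : ℂ} (c : ℂ) (φ ψ : Germ (𝓝 b) ℂ) : φ * (c • ψ) = c • (φ * ψ) :=
  Germ.inductionOn₂ φ ψ fun f g => congrArg _ (mul_smul_comm c f g)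

theorem IsContinuationAlong.mul {b c : ℂ} {γ : Path b c} {φ φ' : Germ (𝓝 b) ℂ}
    {ψ ψ' : Germ (𝓝 c) ℂ} (h : IsContinuationAlong γ φ ψ) (h' : IsContinuationAlong γ φ' ψ') :
    IsContinuationAlong γ (φ * φ') (ψ * ψ') := by
  obtain ⟨F, h1, h2, rfl, rfl⟩ := h
  obtain ⟨F', h1', h2', rfl, rfl⟩ := h'
  refine ⟨fun s => F s * F' s, fun s => (h1 s).mul (h1' s), fun s => ?_, rfl, rfl⟩
  filter_upwards [h2 s, h2' s] with s' hs hs'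
  exact hs.mul hs'

namespace ThetaOperator

variable {P Q : ThetaOperator} {α b w : ℂ}

theorem powBranch_mul_mem_solutionSpace (hQ : P.shift α = Q) (hb : b ∉ P.singularSet)
    (hw : Complex.exp w = b) {φ : Germ (𝓝 b) ℂ} (hφ : φ ∈ P.solutionSpace b) :
    (powBranch α w : Germ (𝓝 b) ℂ) * φ ∈ Q.solutionSpace b := by
  subst hQ
  obtain ⟨y, hy, hPy, rfl⟩ := hφ
  have hs : b * Complex.exp (-w) ∈ Complex.slitPlane := by
    rw [← hw]
    exact exp_mul_exp_neg_mem_slitPlane w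
  refine ⟨powBranch α w * y, (powBranch_analyticAt α hs).mul hy, ?_, rfl⟩
  filter_upwards [hPy, eventually_mem_slitPlane hs, hy.eventually_analyticAt,
    eventually_forall_holomorphicAt (notMem_singularSet.1 hb).2] with t h1 h2 h3 h4
  rw [apply_shift_mul h4 (powBranch_analyticAt α h2) h3 (thetaDeriv_powBranch α h2), h1, mul_zero]

theorem powBranch_neg_mul_mul (α w : ℂ) (φ : Germ (𝓝 b) ℂ) :
    (powBranch (-α) w : Germ (𝓝 b) ℂ) * ((powBranch α w : Germ (𝓝 b) ℂ) * φ) = φ := by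
  rw [← mul_assoc, ← Germ.coe_mul, powBranch_neg_mul, Germ.coe_one, one_mul]

theorem shift_neg_eq (hQ : P.shift α = Q) : Q.shift (-α) = P := by
  rw [← hQ, shift_neg_shift]

theorem notMem_singularSet_of_shift_eq (hQ : P.shift α = Q) (hb : b ∉ P.singularSet) :
    b ∉ Q.singularSet :=
  hQ ▸ notMem_singularSet_shift hb α

/-- Multiplication by a branch of `t ^ α` maps the solutions of `P` onto those of `P(α)`. -/
noncomputable def mulPow (hQ : P.shift α = Q) (hb : b ∉ P.singularSet)
    (hw : Complex.exp w = b) : P.solutionSpace b ≃ₗ[ℂ] Q.solutionSpace b where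
  toFun φ := ⟨(powBranch α w : Germ (𝓝 b) ℂ) * φ,
    powBranch_mul_mem_solutionSpace hQ hb hw φ.2⟩
  invFun ψ := ⟨(powBranch (-α) w : Germ (𝓝 b) ℂ) * ψ,
    powBranch_mul_mem_solutionSpace (shift_neg_eq hQ)
      (notMem_singularSet_of_shift_eq hQ hb) hw ψ.2⟩
  map_add' φ ψ := Subtype.ext (mul_add _ _ _)
  map_smul' c φ := Subtype.ext (germ_mul_smul c _ _)
  left_inv φ := Subtype.ext (powBranch_neg_mul_mul α w _)
  right_inv ψ := Subtype.ext (by simpa using powBranch_neg_mul_mul (-α) w (ψ : Germ (𝓝 b) ℂ))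

theorem exists_mem_monodromyGroup_of_shift_eq (hQ : P.shift α = Q) (hb : b ∉ P.singularSet)
    (hb' : b ∉ Q.singularSet) (hw : Complex.exp w = b)
    {g : P.solutionSpace b ≃ₗ[ℂ] P.solutionSpace b}
    {γ : Path b b} (hγ : ∀ s, γ s ∉ P.singularSet)
    (hg : ∀ y : P.solutionSpace b,
      IsContinuationAlong γ (y : Germ (𝓝 b) ℂ) (g y : Germ (𝓝 b) ℂ))
    {c : ℂ} (hc : c ≠ 0)
    (hu : IsContinuationAlong γ (powBranch α w : Germ (𝓝 b) ℂ) (c • powBranch α w : ℂ → ℂ)) :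
    ∃ g' ∈ Q.monodromyGroup b hb', ∀ y,
      g' (mulPow hQ hb hw y) = c • mulPow hQ hb hw (g y) := by
  let T := mulPow hQ hb hw
  -- The automorphism is `c T g T⁻¹`: products continue to products, and the branch contributes `c`.
  refine ⟨((T.symm.trans g).trans T).trans (LinearEquiv.smulOfNeZero ℂ _ c hc),
    ⟨γ, fun s => notMem_singularSet_of_shift_eq hQ (hγ s), fun y' => ?_⟩, fun y => ?_⟩
  · obtain ⟨y, rfl⟩ := T.surjective y'
    have h := hu.mul (hg y)
    have h1 : ((((T.symm.trans g).trans T).trans (LinearEquiv.smulOfNeZero ℂ _ c hc)) (T y) :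
        Germ (𝓝 b) ℂ) = c • ((powBranch α w : Germ (𝓝 b) ℂ) * (g y : Germ (𝓝 b) ℂ)) := by
      simp only [LinearEquiv.trans_apply, LinearEquiv.symm_apply_apply]
      rfl
    rw [h1, ← germ_smul_mul]
    exact h
  · simp [T]

theorem exists_mem_monodromyGroup_shift (hQ : P.shift α = Q) (hb : b ∉ P.singularSet)
    (hb' : b ∉ Q.singularSet) (hw : Complex.exp w = b)
    {g : P.solutionSpace b ≃ₗ[ℂ] P.solutionSpace b} (hg : g ∈ P.monodromyGroup b hb) :
    ∃ n : ℤ, ∃ g' ∈ Q.monodromyGroup b hb', ∀ y, g' (mulPow hQ hb hw y) =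
      Complex.exp (n * (2 * Real.pi * Complex.I) * α) • mulPow hQ hb hw (g y) := by
  obtain ⟨γ, hγ, hg⟩ := hg
  obtain ⟨n, hn⟩ := exists_powBranch_isContinuationAlong_loop α γ
    (fun s => (notMem_singularSet.1 (hγ s)).1) hw
  exact ⟨n, exists_mem_monodromyGroup_of_shift_eq hQ hb hb' hw hγ hg (Complex.exp_ne_zero _) hn⟩

/-- `P` is the shift of `Q` by `-α`, with `mulPow` inverted, so the forward comparison applies; the
scalar it yields is the inverse one and moves to the other side. -/
theorem exists_mem_monodromyGroup_unshift (hQ : P.shift α = Q) (hb : b ∉ P.singularSet)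
    (hb' : b ∉ Q.singularSet) (hw : Complex.exp w = b)
    {g' : Q.solutionSpace b ≃ₗ[ℂ] Q.solutionSpace b} (hg' : g' ∈ Q.monodromyGroup b hb') :
    ∃ n : ℤ, ∃ g ∈ P.monodromyGroup b hb, ∀ y, g' (mulPow hQ hb hw y) =
      Complex.exp (n * (2 * Real.pi * Complex.I) * α) • mulPow hQ hb hw (g y) := by
  obtain ⟨n, g, hg, h⟩ := exists_mem_monodromyGroup_shift (shift_neg_eq hQ) hb' hb hw hg'
  refine ⟨n, g, hg, fun y => ?_⟩
  have h1 : ∀ y', mulPow (shift_neg_eq hQ) hb' hw y' = (mulPow hQ hb hw).symm y' := fun _ => rfl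
  have h2 := h (mulPow hQ hb hw y)
  rw [h1, h1, LinearEquiv.symm_apply_apply] at h2
  rw [h2, map_smul, LinearEquiv.apply_symm_apply, smul_smul, ← Complex.exp_add]
  simp

end ThetaOperator

/-! ### Local extension of solutions and the loop around the origin -/

namespace ThetaOperator

variable {P : ThetaOperator} {b : ℂ}

theorem mem_solutionSpace {y : ℂ → ℂ} (hy : AnalyticAt ℂ y b)
    (hP : ∀ᶠ t in 𝓝 b, P.apply y t = 0) : (y : Germ (𝓝 b) ℂ) ∈ P.solutionSpace b :=
  ⟨y, hy, hP, rfl⟩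

/-- If the dimension of the space of solutions is the same at all points, then the solutions form
a locally constant sheaf: they extend to a fixed disk. -/
theorem exists_ball_equiv {ι : Type*} [Fintype ι]
    (hP : ∀ b ∉ P.singularSet, Nonempty (Module.Basis ι ℂ (P.solutionSpace b)))
    (hb : b ∉ P.singularSet) :
    ∃ ε > 0, (∀ c ∈ Metric.ball b ε, c ∉ P.singularSet) ∧ ∀ c ∈ Metric.ball b ε,
      ∃ g : P.solutionSpace b ≃ₗ[ℂ] P.solutionSpace c, ∀ φ : P.solutionSpace b, ∃ y : ℂ → ℂ,
        AnalyticOnNhd ℂ y (Metric.ball b ε) ∧ (φ : Germ (𝓝 b) ℂ) = y ∧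
          (g φ : Germ (𝓝 c) ℂ) = y := by
  obtain ⟨B⟩ := hP b hb
  choose y hy hPy hBy using fun i => (B i).2
  have hev : ∀ᶠ t in 𝓝 b, (∀ i, AnalyticAt ℂ (y i) t ∧ P.apply (y i) t = 0) ∧
      t ∉ P.singularSet :=
    (eventually_all.2 fun i => (hy i).eventually_analyticAt.and (hPy i)).and
      (eventually_notMem_singularSet hb)
  obtain ⟨ε, hε, hball⟩ := Metric.eventually_nhds_iff_ball.1 hev
  refine ⟨ε, hε, fun c hc => (hball c hc).2, fun c hc => ?_⟩
  have hmem : ∀ i, (y i : Germ (𝓝 c) ℂ) ∈ P.solutionSpace c := fun i =>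
    mem_solutionSpace ((hball c hc).1 i).1
      (eventually_of_mem (Metric.isOpen_ball.mem_nhds hc) fun t ht => ((hball t ht).1 i).2)
  let f : P.solutionSpace b →ₗ[ℂ] P.solutionSpace c := B.constr ℂ fun i => ⟨y i, hmem i⟩
  have hcoe : ∀ (x : ℂ) (a : ι → ℂ), ((∑ i, a i • y i : ℂ → ℂ) : Germ (𝓝 x) ℂ) =
      ∑ i, a i • (y i : Germ (𝓝 x) ℂ) := fun x a => by
    have := map_sum (Germ.coeAddHom (𝓝 x) : (ℂ → ℂ) →+ _) (fun i => a i • y i) Finset.univ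
    exact this
  have han : ∀ a : ι → ℂ, AnalyticOnNhd ℂ (∑ i, a i • y i) (Metric.ball b ε) := fun a t ht =>
    Finset.analyticAt_sum _ fun i _ => ((hball t ht).1 i).1.const_smul
  have hφ : ∀ φ : P.solutionSpace b,
      (φ : Germ (𝓝 b) ℂ) = (∑ i, B.repr φ i • y i : ℂ → ℂ) := fun φ => by
    rw [hcoe]
    conv_lhs => rw [← B.sum_repr φ]
    simp only [Submodule.coe_sum, Submodule.coe_smul, hBy]
  have hf : ∀ φ : P.solutionSpace b,
      (f φ : Germ (𝓝 c) ℂ) = (∑ i, B.repr φ i • y i : ℂ → ℂ) := fun φ => by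
    rw [hcoe]
    simp [f, Module.Basis.constr_apply_fintype]
  have hinj : Function.Injective f := by
    rw [injective_iff_map_eq_zero]
    intro φ h0
    have h1 := hf φ
    rw [h0] at h1
    have h2 : (∑ i, B.repr φ i • y i) =ᶠ[𝓝 c] 0 := Germ.coe_eq.1 h1.symm
    -- Identity theorem: a combination vanishing near `c` vanishes on the whole disk, hence near
    -- `b`.
    have h3 := (han (B.repr φ)).eqOn_zero_of_preconnected_of_eventuallyEq_zero
      (convex_ball b ε).isPreconnected hc h2
    apply Subtype.ext
    rw [hφ φ]
    exact Germ.coe_eq.2 (eventually_of_mem (Metric.ball_mem_nhds b hε) h3)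
  obtain ⟨B'⟩ := hP c (hball c hc).2
  have : FiniteDimensional ℂ (P.solutionSpace b) := B.finiteDimensional_of_finite
  have : FiniteDimensional ℂ (P.solutionSpace c) := B'.finiteDimensional_of_finite
  -- Equal dimensions make the injective extension map bijective; no existence theorem for solutions
  -- at `c` is needed.
  have hdim : Module.finrank ℂ (P.solutionSpace b) = Module.finrank ℂ (P.solutionSpace c) := by
    rw [Module.finrank_eq_card_basis B, Module.finrank_eq_card_basis B']
  refine ⟨LinearEquiv.ofBijective f
    ⟨hinj, (LinearMap.injective_iff_surjective_of_finrank_eq_finrank hdim).1 hinj⟩, fun φ => ?_⟩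
  exact ⟨_, han (B.repr φ), hφ φ, hf φ⟩

/-- Some path from `b` to `c` continues all solutions at `b` to solutions at `c`, and the branch
of `t ^ α` belonging to `w` to the one belonging to `w'`. -/
def ContinuesTo (P : ThetaOperator) (α b c w w' : ℂ) : Prop :=
  ∃ γ : Path b c, (∀ s, γ s ∉ P.singularSet) ∧
    (∃ g : P.solutionSpace b ≃ₗ[ℂ] P.solutionSpace c, ∀ y : P.solutionSpace b,
      IsContinuationAlong γ (y : Germ (𝓝 b) ℂ) (g y : Germ (𝓝 c) ℂ)) ∧
    IsContinuationAlong γ (powBranch α w : Germ (𝓝 b) ℂ) (powBranch α w' : Germ (𝓝 c) ℂ)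

theorem ContinuesTo.symm {α b c w w' : ℂ} (h : P.ContinuesTo α b c w w') :
    P.ContinuesTo α c b w' w := by
  obtain ⟨γ, h1, ⟨g, h2⟩, h3⟩ := h
  refine ⟨γ.symm, fun s => h1 _, ⟨g.symm, fun y => ?_⟩, h3.symm⟩
  have := (h2 (g.symm y)).symm
  rwa [LinearEquiv.apply_symm_apply] at this

theorem ContinuesTo.trans {α b c d w w' w'' : ℂ} (h : P.ContinuesTo α b c w w')
    (h' : P.ContinuesTo α c d w' w'') : P.ContinuesTo α b d w w'' := by
  obtain ⟨γ, h1, ⟨g, h2⟩, h3⟩ := h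
  obtain ⟨γ', h1', ⟨g', h2'⟩, h3'⟩ := h'
  refine ⟨γ.trans γ', fun s => ?_, ⟨g.trans g', fun y => (h2 y).trans (h2' (g y))⟩, h3.trans h3'⟩
  rw [Path.trans_apply]
  split_ifs
  · exact h1 _
  · exact h1' _

theorem isContinuationAlong_of_analyticOnNhd {b c : ℂ} {S : Set ℂ} {y : ℂ → ℂ}
    (hy : AnalyticOnNhd ℂ y S) (γ : Path b c) (hγ : ∀ s, γ s ∈ S) :
    IsContinuationAlong γ (y : Germ (𝓝 b) ℂ) (y : Germ (𝓝 c) ℂ) :=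
  ⟨fun _ => y, fun s => hy _ (hγ s), fun _ => Eventually.of_forall fun _ => EventuallyEq.rfl,
    rfl, rfl⟩

/-- On a small disk around `exp w` all solutions and the branch of `t ^ α` are single-valued, so any
path inside the disk serves. -/
theorem eventually_continuesTo {ι : Type*} [Fintype ι]
    (hP : ∀ b ∉ P.singularSet, Nonempty (Module.Basis ι ℂ (P.solutionSpace b))) (α : ℂ) {w : ℂ}
    (hw : Complex.exp w ∉ P.singularSet) :
    ∀ᶠ w' in 𝓝 w, P.ContinuesTo α (Complex.exp w) (Complex.exp w') w w' := by
  obtain ⟨ε, hε, h1, h2⟩ := exists_ball_equiv hP hw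
  obtain ⟨δ, hδ, h3⟩ := Metric.eventually_nhds_iff_ball.1
    (eventually_mem_slitPlane (exp_mul_exp_neg_mem_slitPlane w))
  have hc : ContinuousAt Complex.exp w := Complex.continuous_exp.continuousAt
  have hc' : ContinuousAt (fun w' => |(w' - w).im|) w := by fun_prop
  have h0 : |(w - w).im| < Real.pi / 2 := by simpa using Real.pi_pos
  filter_upwards [hc.eventually (Metric.ball_mem_nhds _ (lt_min hε hδ)),
    hc'.eventually (gt_mem_nhds h0)] with w' h4 h5
  have hsub : Metric.ball (Complex.exp w) (min ε δ) ⊆ Metric.ball (Complex.exp w) ε :=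
    Metric.ball_subset_ball (min_le_left _ _)
  have hsub' : Metric.ball (Complex.exp w) (min ε δ) ⊆ Metric.ball (Complex.exp w) δ :=
    Metric.ball_subset_ball (min_le_right _ _)
  obtain ⟨γ, hγ⟩ := ((convex_ball (Complex.exp w) (min ε δ)).isPathConnected
    ⟨_, Metric.mem_ball_self (lt_min hε hδ)⟩).joinedIn _ (Metric.mem_ball_self (lt_min hε hδ)) _ h4
  obtain ⟨g, hg⟩ := h2 _ (hsub h4)
  refine ⟨γ, fun s => h1 _ (hsub (hγ s)), ⟨g, fun φ => ?_⟩, ?_⟩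
  · obtain ⟨y, h6, h7, h8⟩ := hg φ
    rw [h7, h8]
    exact isContinuationAlong_of_analyticOnNhd h6 γ fun s => hsub (hγ s)
  · rw [Germ.coe_eq.2 (powBranch_eventuallyEq α h5)]
    exact isContinuationAlong_of_analyticOnNhd
      (fun t ht => powBranch_analyticAt α (h3 t (hsub' ht))) γ hγ

/-- Continuation along a circle around the origin whose disk contains no other singular point. -/
theorem exists_loop_around_zero {ι : Type*} [Fintype ι]
    (hP : ∀ b ∉ P.singularSet, Nonempty (Module.Basis ι ℂ (P.solutionSpace b))) (α : ℂ)
    (h0 : ∀ i, (P.coeff i).HolomorphicAt 0) :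
    ∃ w : ℂ, Complex.exp w ∉ P.singularSet ∧ P.ContinuesTo α (Complex.exp w) (Complex.exp w) w
      (w + 2 * Real.pi * Complex.I) := by
  obtain ⟨r, hr, h1⟩ := Metric.eventually_nhds_iff_ball.1 (eventually_forall_holomorphicAt h0)
  -- `exp (w θ)` runs through the circle of radius `r / 2`, inside the disk where the coefficients
  -- are holomorphic.
  let w : ℝ → ℂ := fun θ => Real.log (r / 2) + θ * Complex.I
  have hw : ∀ θ, Complex.exp (w θ) ∉ P.singularSet := fun θ => by
    refine notMem_singularSet.2 ⟨Complex.exp_ne_zero _, h1 _ ?_⟩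
    rw [mem_ball_zero_iff, Complex.norm_exp]
    simp [w, Real.exp_log (half_pos hr), hr]
  have hcont : Continuous w := by fun_prop
  -- The relation is symmetric and transitive and holds between nearby angles, so connectedness of
  -- `ℝ` links `0` with `2π`.
  have key := isPreconnected_univ.induction₂
    (fun θ θ' : ℝ => P.ContinuesTo α (Complex.exp (w θ)) (Complex.exp (w θ')) (w θ) (w θ'))
    (fun θ _ => by
      rw [nhdsWithin_univ]
      exact hcont.continuousAt.eventually (eventually_continuesTo hP α (hw θ)))
    (fun _ _ _ _ _ _ h h' => h.trans h') (fun _ _ _ _ h => h.symm)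
    (Set.mem_univ 0) (Set.mem_univ (2 * Real.pi))
  have h2 : w (2 * Real.pi) = w 0 + 2 * Real.pi * Complex.I := by simp [w]
  refine ⟨w 0, hw 0, ?_⟩
  simp only [h2, Complex.exp_periodic (w 0)] at key
  exact key

/-- Winding number exactly one makes the scalar `exp (2πiα)` itself. The base point is chosen close
to the origin, which is harmless because being symplectic is a condition at every base point. -/
theorem exists_monodromy_around_zero {ι : Type*} [Fintype ι] {P Q : ThetaOperator} {α : ℂ}
    (hP : ∀ b ∉ P.singularSet, Nonempty (Module.Basis ι ℂ (P.solutionSpace b)))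
    (h0 : ∀ i, (P.coeff i).HolomorphicAt 0) (hQ : P.shift α = Q) :
    ∃ (b w : ℂ) (hb : b ∉ P.singularSet) (hb' : b ∉ Q.singularSet) (hw : Complex.exp w = b),
      ∃ g ∈ P.monodromyGroup b hb, ∃ g' ∈ Q.monodromyGroup b hb', ∀ y,
        g' (mulPow hQ hb hw y) =
          Complex.exp (2 * Real.pi * Complex.I * α) • mulPow hQ hb hw (g y) := by
  obtain ⟨w, hb, γ, hγ, ⟨g, hg⟩, hu⟩ := exists_loop_around_zero hP α h0
  have h := powBranch_add_two_pi α w 1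
  simp only [Int.cast_one, one_mul] at h
  rw [h] at hu
  exact ⟨_, w, hb, notMem_singularSet_of_shift_eq hQ hb, rfl, g, ⟨γ, hγ, hg⟩,
    exists_mem_monodromyGroup_of_shift_eq hQ hb _ rfl hγ hg (Complex.exp_ne_zero _) hu⟩

end ThetaOperator

/-! ### Integral monodromy matrices when `2α` is an integer -/

/-- The matrices in `Sp(4, ℤ)` that represent an element of `H` in the basis `B`. -/
noncomputable def intMatrices {V : Type*} [AddCommGroup V] [Module ℂ V]
    (B : Module.Basis (Fin 2 ⊕ Fin 2) ℂ V) (H : Subgroup (V ≃ₗ[ℂ] V)) : Subgroup SpFourInt where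
  carrier := {A | ∃ g ∈ H, LinearMap.toMatrix B B (g : V →ₗ[ℂ] V) =
    (A : Matrix (Fin 2 ⊕ Fin 2) (Fin 2 ⊕ Fin 2) ℤ).map (Int.cast : ℤ → ℂ)}
  one_mem' := ⟨1, H.one_mem, by simp⟩
  mul_mem' := by
    rintro A A' ⟨g, hg, h⟩ ⟨g', hg', h'⟩
    refine ⟨g * g', H.mul_mem hg hg', ?_⟩
    have h1 : ((g * g' : V ≃ₗ[ℂ] V) : V →ₗ[ℂ] V) = (g : V →ₗ[ℂ] V) ∘ₗ (g' : V →ₗ[ℂ] V) := rfl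
    rw [h1, LinearMap.toMatrix_comp B B B, h, h']
    exact (Matrix.map_mul (f := Int.castRingHom ℂ)).symm
  inv_mem' := by
    rintro A ⟨g, hg, h⟩
    refine ⟨g⁻¹, H.inv_mem hg, ?_⟩
    have h1 : LinearMap.toMatrix B B ((g⁻¹ : V ≃ₗ[ℂ] V) : V →ₗ[ℂ] V) *
        LinearMap.toMatrix B B (g : V →ₗ[ℂ] V) = 1 := by
      rw [← LinearMap.toMatrix_comp B B B]
      convert LinearMap.toMatrix_one B
      ext x
      exact congrArg (fun e : V ≃ₗ[ℂ] V => e x) (inv_mul_cancel g)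
    have h2 : (A : Matrix (Fin 2 ⊕ Fin 2) (Fin 2 ⊕ Fin 2) ℤ) * (A⁻¹ : SpFourInt) = 1 :=
      congrArg Subtype.val (mul_inv_cancel A)
    have h3 := congrArg (fun M => M.map (Int.castRingHom ℂ)) h2
    simp only [Matrix.map_mul] at h3
    rw [h] at h1
    refine left_inv_eq_right_inv h1 (h3.trans ?_)
    simp

theorem toMatrix_map_eq_smul {V W : Type*} [AddCommGroup V] [Module ℂ V] [AddCommGroup W]
    [Module ℂ W] (B : Module.Basis (Fin 2 ⊕ Fin 2) ℂ V) (T : V ≃ₗ[ℂ] W) {g : V →ₗ[ℂ] V}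
    {g' : W →ₗ[ℂ] W} {c : ℂ} (h : ∀ y, g' (T y) = c • T (g y)) :
    LinearMap.toMatrix (B.map T) (B.map T) g' = c • LinearMap.toMatrix B B g := by
  ext i j
  simp [LinearMap.toMatrix_apply, h]

theorem exp_sq_eq_one {α : ℂ} {k : ℤ} (hk : 2 * α = k) (n : ℤ) :
    Complex.exp (n * (2 * Real.pi * Complex.I) * α) = 1 ∨
      Complex.exp (n * (2 * Real.pi * Complex.I) * α) = -1 := by
  rw [← sq_eq_one_iff, ← Complex.exp_nat_mul, Complex.exp_eq_one_iff]
  exact ⟨n * k, by push_cast; rw [← hk]; ring⟩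

/-- The element `-1` of `Sp(4, ℤ)`. -/
def SpFourInt.negOne : SpFourInt := ⟨-1, SymplecticGroup.neg_mem (one_mem _)⟩

theorem SpFourInt.coe_negOne_mul (A : SpFourInt) :
    ((SpFourInt.negOne * A : SpFourInt) : Matrix (Fin 2 ⊕ Fin 2) (Fin 2 ⊕ Fin 2) ℤ) = -A := by
  simp [SpFourInt.negOne]

theorem SpFourInt.map_negOne_mul (A : SpFourInt) :
    ((SpFourInt.negOne * A : SpFourInt) : Matrix (Fin 2 ⊕ Fin 2) (Fin 2 ⊕ Fin 2) ℤ).map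
      (Int.cast : ℤ → ℂ) =
    -(A : Matrix (Fin 2 ⊕ Fin 2) (Fin 2 ⊕ Fin 2) ℤ).map (Int.cast : ℤ → ℂ) := by
  rw [SpFourInt.coe_negOne_mul]
  ext
  simp

namespace ThetaOperator

theorem exists_exp_eq {P : ThetaOperator} {b : ℂ} (hb : b ∉ P.singularSet) :
    ∃ w, Complex.exp w = b :=
  ⟨_, Complex.exp_log (notMem_singularSet.1 hb).1⟩

/-- In the basis transported by `mulPow` the matrices for `Q` are those for `P` up to sign, hence
still in `Sp(4, ℤ)`. The sign depends on the loop, so `G'` is only controlled element by element. -/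
theorem MonodromyConjugateTo.shift {P Q : ThetaOperator} {α b : ℂ} {k : ℤ} (hk : 2 * α = k)
    (hQ : P.shift α = Q) {hb : b ∉ P.singularSet} (hb' : b ∉ Q.singularSet)
    {G : Subgroup SpFourInt} (hG : P.MonodromyConjugateTo b hb G) :
    ∃ G' : Subgroup SpFourInt, Q.MonodromyConjugateTo b hb' G' ∧
      ∀ A ∈ G, A ∈ G' ∨ SpFourInt.negOne * A ∈ G' := by
  obtain ⟨B, hB⟩ := hG
  obtain ⟨w, hw⟩ := exists_exp_eq hb
  refine ⟨intMatrices (B.map (mulPow hQ hb hw)) (Q.monodromyGroup b hb'),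
    ⟨B.map (mulPow hQ hb hw), ?_⟩, fun A hA => ?_⟩
  · apply Set.Subset.antisymm
    · rintro _ ⟨g', hg', rfl⟩
      obtain ⟨n, g, hg, h⟩ := exists_mem_monodromyGroup_unshift hQ hb hb' hw hg'
      have hm := toMatrix_map_eq_smul B (mulPow hQ hb hw) (g := g) (g' := g') h
      obtain ⟨A, -, hA⟩ := hB.subset ⟨g, hg, rfl⟩
      simp only at hA
      rcases exp_sq_eq_one hk n with hc | hc
      · rw [hc, one_smul, ← hA] at hm
        exact ⟨A, ⟨g', hg', hm⟩, hm.symm⟩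
      · rw [hc, neg_one_smul, ← hA, ← SpFourInt.map_negOne_mul] at hm
        exact ⟨_, ⟨g', hg', hm⟩, hm.symm⟩
    · rintro _ ⟨A, ⟨g', hg', h⟩, rfl⟩
      exact ⟨g', hg', h⟩
  · obtain ⟨g, hg, hgA⟩ := hB.superset ⟨A, hA, rfl⟩
    simp only at hgA
    obtain ⟨n, g', hg', h⟩ := exists_mem_monodromyGroup_shift hQ hb hb' hw hg
    have hm := toMatrix_map_eq_smul B (mulPow hQ hb hw) (g := g) (g' := g') h
    rw [hgA] at hm
    rcases exp_sq_eq_one hk n with hc | hc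
    · rw [hc, one_smul] at hm
      exact Or.inl ⟨g', hg', hm⟩
    · rw [hc, neg_one_smul, ← SpFourInt.map_negOne_mul] at hm
      exact Or.inr ⟨g', hg', hm⟩

end ThetaOperator

/-! ### Finite index and Zariski density under sign changes -/

/-- Since `G ⊆ G' ∪ ν⁻¹ G'`, each coset of `G` is covered by two cosets of `G'`, which bounds the
index of `G'` by twice that of `G`. -/
theorem Subgroup.finiteIndex_of_mem_or_mul_mem {S : Type*} [Group S] {G G' : Subgroup S} (ν : S)
    (hG : G.FiniteIndex) (h : ∀ A ∈ G, A ∈ G' ∨ ν * A ∈ G') : G'.FiniteIndex := by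
  let f : (S ⧸ G) × Bool → S ⧸ G' := fun q =>
    ((q.1.out * (if q.2 then 1 else ν⁻¹) : S) : S ⧸ G')
  have hf : Function.Surjective f := by
    intro x
    induction x using QuotientGroup.induction_on with | H x => ?_
    obtain ⟨g, hg⟩ := QuotientGroup.mk_out_eq_mul G x
    rcases h g⁻¹ (G.inv_mem g.2) with h1 | h1
    · refine ⟨((x : S ⧸ G), true), QuotientGroup.eq.2 ?_⟩
      simpa [hg] using h1
    · refine ⟨((x : S ⧸ G), false), QuotientGroup.eq.2 ?_⟩
      simpa [hg, mul_assoc] using h1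
  have := Finite.of_surjective f hf
  exact Subgroup.finiteIndex_of_finite_quotient

/-- As `J² = -1`, this is `exp (θ J)`: an entire curve in the group through `1` at `θ = 0` and `-1`
at `θ = π`. -/
theorem cos_add_sin_J_mem (θ : ℂ) :
    Complex.cos θ • (1 : Matrix (Fin 2 ⊕ Fin 2) (Fin 2 ⊕ Fin 2) ℂ) +
      Complex.sin θ • Matrix.J (Fin 2) ℂ ∈ Matrix.symplecticGroup (Fin 2) ℂ := by
  rw [SymplecticGroup.mem_iff]
  have h := Complex.cos_sq_add_sin_sq θ
  have h1 := Matrix.J_squared (Fin 2) ℂ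
  simp only [Matrix.transpose_add, Matrix.transpose_smul, Matrix.transpose_one,
    Matrix.J_transpose, add_mul, mul_add, smul_mul_assoc, mul_smul_comm, one_mul, mul_one,
    mul_neg, h1, neg_mul, smul_neg]
  match_scalars
  · linear_combination h
  · ring

/-- The identity `f(A) f(-A) = 0` on `Sp(4, ℂ)` forces `f = 0` there, since `A` and
`-A` are joined by an analytic curve. -/
theorem eval_eq_zero_of_eval_mul_eval_neg_eq_zero
    {f : MvPolynomial ((Fin 2 ⊕ Fin 2) × (Fin 2 ⊕ Fin 2)) ℂ}
    (h : ∀ A ∈ Matrix.symplecticGroup (Fin 2) ℂ,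
      MvPolynomial.eval (fun ij => A ij.1 ij.2) f *
        MvPolynomial.eval (fun ij => (-A) ij.1 ij.2) f = 0)
    {A : Matrix (Fin 2 ⊕ Fin 2) (Fin 2 ⊕ Fin 2) ℂ} (hA : A ∈ Matrix.symplecticGroup (Fin 2) ℂ) :
    MvPolynomial.eval (fun ij => A ij.1 ij.2) f = 0 := by
  let M : ℂ → Matrix (Fin 2 ⊕ Fin 2) (Fin 2 ⊕ Fin 2) ℂ := fun θ =>
    A * (Complex.cos θ • 1 + Complex.sin θ • Matrix.J (Fin 2) ℂ)
  have hM : ∀ θ, M θ ∈ Matrix.symplecticGroup (Fin 2) ℂ := fun θ =>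
    mul_mem hA (cos_add_sin_J_mem θ)
  have hentry : ∀ i j, AnalyticOnNhd ℂ (fun θ => M θ i j) Set.univ := by
    intro i j
    simp only [M, mul_add, mul_smul_comm, mul_one, Matrix.add_apply, Matrix.smul_apply, smul_eq_mul]
    intro θ _
    fun_prop
  have han : ∀ s : ℂ, AnalyticOnNhd ℂ
      (fun θ => MvPolynomial.eval (fun ij => (s • M θ) ij.1 ij.2) f) Set.univ := by
    intro s θ hθ
    refine AnalyticAt.aeval_mvPolynomial (fun ij => ?_) f
    exact analyticAt_const.mul (hentry ij.1 ij.2 θ hθ)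
  -- One of the entire functions `f(M θ)` and `f(-M θ)` vanishes identically. The first takes the
  -- value `f(A)` at `0`, the second at `π`.
  have hzero := (han 1).eq_zero_or_eq_zero_of_mul_eq_zero (han (-1))
    (fun θ _ => by simpa using h _ (hM θ)) isPreconnected_univ
  rcases hzero with h0 | h0
  · simpa [M] using h0 0 (Set.mem_univ _)
  · simpa [M] using h0 Real.pi (Set.mem_univ _)

theorem IsZariskiDense.of_mem_or_neg_mem {G G' : Subgroup SpFourInt} (hG : IsZariskiDense G)
    (h : ∀ A ∈ G, A ∈ G' ∨ SpFourInt.negOne * A ∈ G') : IsZariskiDense G' := by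
  intro f hf A hA
  let f' : MvPolynomial ((Fin 2 ⊕ Fin 2) × (Fin 2 ⊕ Fin 2)) ℂ :=
    MvPolynomial.bind₁ (fun ij => -MvPolynomial.X ij) f
  have hf' : ∀ x, MvPolynomial.eval x f' = MvPolynomial.eval (fun ij => -x ij) f := fun x => by
    simp only [f', MvPolynomial.eval, MvPolynomial.eval₂Hom_bind₁]
    simp
  refine eval_eq_zero_of_eval_mul_eval_neg_eq_zero (fun A hA => ?_) hA
  -- `f(X) f(-X)` vanishes on `G`, because `f` vanishes at `A` or at `-A`.
  have := hG (f * f') (fun A hA => ?_) A hA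
  · rw [map_mul, hf'] at this
    exact this
  · rw [map_mul, hf']
    rcases h A hA with h1 | h1
    · rw [hf A h1, zero_mul]
    · have h2 := hf _ h1
      simp only [SpFourInt.coe_negOne_mul, Matrix.neg_apply, Int.cast_neg] at h2
      rw [h2, mul_zero]

/-! ### Bilinear forms preserved up to scalars -/

theorem fromBlocks_one_mem_symplecticGroup {S : Matrix (Fin 2) (Fin 2) ℂ} (hS : S.transpose = S) :
    Matrix.fromBlocks 1 S 0 1 ∈ Matrix.symplecticGroup (Fin 2) ℂ := by
  rw [SymplecticGroup.mem_iff]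
  simp [Matrix.J, Matrix.fromBlocks_transpose, Matrix.fromBlocks_multiply, hS]

/-- A unipotent element of `Sp(4, ℂ)` that maps `Ω` to a multiple fixes `Ω`. -/
theorem fromBlocks_one_mul_mul_transpose {Ω : Matrix (Fin 2 ⊕ Fin 2) (Fin 2 ⊕ Fin 2) ℂ}
    (hΩ : Ω.det ≠ 0)
    (h : ∀ A ∈ Matrix.symplecticGroup (Fin 2) ℂ, ∃ c : ℂ, A * Ω * A.transpose = c • Ω)
    {S : Matrix (Fin 2) (Fin 2) ℂ} (hS : S.transpose = S) :
    (Matrix.fromBlocks 1 S 0 1 : Matrix (Fin 2 ⊕ Fin 2) (Fin 2 ⊕ Fin 2) ℂ) * Ω *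
      (Matrix.fromBlocks 1 S 0 1).transpose = Ω := by
  -- The unipotent element is the fourth power of the one with block `S / 4`. Determinants of size
  -- `4` show that the scalar `c` of the latter satisfies `c ^ 4 = 1`.
  have hS' : ((4 : ℂ)⁻¹ • S).transpose = (4 : ℂ)⁻¹ • S := by rw [Matrix.transpose_smul, hS]
  obtain ⟨c, hc⟩ := h _ (fromBlocks_one_mem_symplecticGroup hS')
  set U : Matrix (Fin 2 ⊕ Fin 2) (Fin 2 ⊕ Fin 2) ℂ :=
    Matrix.fromBlocks 1 ((4 : ℂ)⁻¹ • S) 0 1 with hU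
  have hc4 : c ^ 4 = 1 := by
    have h1 := congrArg Matrix.det hc
    rw [Matrix.det_mul, Matrix.det_mul, Matrix.det_transpose, Matrix.det_smul, hU,
      Matrix.det_fromBlocks_zero₂₁] at h1
    simp only [Matrix.det_one, mul_one, one_mul, Fintype.card_sum, Fintype.card_fin] at h1
    exact mul_right_cancel₀ hΩ (by rw [one_mul]; exact h1.symm)
  have hU4 : Matrix.fromBlocks 1 S 0 1 = U * (U * (U * U)) := by
    simp only [hU, Matrix.fromBlocks_multiply]
    congr 1 <;> simp
    module
  have hmul : ∀ (X : Matrix (Fin 2 ⊕ Fin 2) (Fin 2 ⊕ Fin 2) ℂ) (x : ℂ),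
      X * Ω * X.transpose = x • Ω → (U * X) * Ω * (U * X).transpose = (x * c) • Ω := by
    intro X x hX
    calc (U * X) * Ω * (U * X).transpose = U * (X * Ω * X.transpose) * U.transpose := by
          rw [Matrix.transpose_mul]; simp only [Matrix.mul_assoc]
      _ = x • (U * Ω * U.transpose) := by rw [hX, Matrix.mul_smul, Matrix.smul_mul]
      _ = (x * c) • Ω := by rw [hc, smul_smul]
  rw [hU4, hmul _ _ (hmul _ _ (hmul _ _ hc)),
    show c * c * c * c = c ^ 4 by ring, hc4, one_smul]

/-- A non-degenerate form that is preserved up to scalars by `Sp(4, ℂ)` is a multiple of the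
standard symplectic form. -/
theorem exists_eq_smul_J {Ω : Matrix (Fin 2 ⊕ Fin 2) (Fin 2 ⊕ Fin 2) ℂ} (hΩ : Ω.det ≠ 0)
    (h : ∀ A ∈ Matrix.symplecticGroup (Fin 2) ℂ, ∃ c : ℂ, A * Ω * A.transpose = c • Ω) :
    ∃ x : ℂ, Ω = x • Matrix.J (Fin 2) ℂ := by
  have hS := fun S hS => fromBlocks_one_mul_mul_transpose hΩ h (S := S) hS
  obtain ⟨c, hJ⟩ := h _ (SymplecticGroup.J_mem (Fin 2) ℂ)
  obtain ⟨p, q, r, d, rfl⟩ : ∃ p q r d, Ω = Matrix.fromBlocks p q r d :=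
    ⟨_, _, _, _, (Matrix.fromBlocks_toBlocks Ω).symm⟩
  simp only [Matrix.fromBlocks_transpose, Matrix.fromBlocks_multiply, Matrix.fromBlocks_inj,
    Matrix.transpose_one, Matrix.transpose_zero, one_mul, mul_one, zero_mul, mul_zero,
    zero_add] at hS
  -- `S = 1` kills the lower right block and gives `r = -q`; a general symmetric `S` then has to
  -- commute with `q`.
  obtain ⟨h11, h12, -, -⟩ := hS 1 Matrix.transpose_one
  simp only [one_mul, mul_one, Matrix.transpose_one] at h11 h12
  have hd : d = 0 := by simpa using h12
  subst hd
  have hr : r = -q := by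
    have : r + q = 0 := by simpa [add_assoc] using h11
    exact eq_neg_of_add_eq_zero_left this
  subst hr
  have hcomm : ∀ S : Matrix (Fin 2) (Fin 2) ℂ, S.transpose = S → q * S = S * q := by
    intro S hST
    obtain ⟨h1, -, -, -⟩ := hS S hST
    rw [hST] at h1
    have h2 : -(S * q) + q * S = 0 := by simpa [add_assoc] using h1
    rw [neg_add_eq_zero] at h2
    exact h2.symm
  -- `J` exchanges the diagonal blocks up to the scalar `c`, so `d = 0` gives `p = 0`.
  have hp : p = 0 := by
    simp only [Matrix.J, Matrix.fromBlocks_transpose, Matrix.fromBlocks_multiply,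
      Matrix.fromBlocks_smul, Matrix.fromBlocks_inj] at hJ
    simpa using hJ.2.2.2
  subst hp
  -- Commuting with these two symmetric matrices already makes `q` scalar.
  have e1 := hcomm !![1, 0; 0, 0] (by ext i j; fin_cases i <;> fin_cases j <;> rfl)
  have e2 := hcomm !![0, 1; 1, 0] (by ext i j; fin_cases i <;> fin_cases j <;> rfl)
  have q01 : q 0 1 = 0 := by
    simpa [Matrix.mul_apply, Fin.sum_univ_two] using (congrFun (congrFun e1 0) 1).symm
  have q10 : q 1 0 = 0 := by
    simpa [Matrix.mul_apply, Fin.sum_univ_two] using congrFun (congrFun e1 1) 0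
  have q11 : q 0 0 = q 1 1 := by
    simpa [Matrix.mul_apply, Fin.sum_univ_two] using congrFun (congrFun e2 0) 1
  have hq : q = q 0 0 • (1 : Matrix (Fin 2) (Fin 2) ℂ) := by
    ext i j
    fin_cases i <;> fin_cases j <;> simp [q01, q10, q11]
  refine ⟨-q 0 0, ?_⟩
  rw [Matrix.J, Matrix.fromBlocks_smul]
  congr 1 <;> simp [← hq]

/-- If a Zariski-dense subgroup of `Sp(4, ℤ)` preserves a form up to scalars, then so does
`Sp(4, ℂ)`. -/
theorem IsZariskiDense.exists_smul {G : Subgroup SpFourInt} (hG : IsZariskiDense G)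
    {Ω : Matrix (Fin 2 ⊕ Fin 2) (Fin 2 ⊕ Fin 2) ℂ} (hΩ : Ω.det ≠ 0)
    (h : ∀ A ∈ G, ∃ c : ℂ,
      (A : Matrix (Fin 2 ⊕ Fin 2) (Fin 2 ⊕ Fin 2) ℤ).map (Int.cast : ℤ → ℂ) * Ω *
        ((A : Matrix (Fin 2 ⊕ Fin 2) (Fin 2 ⊕ Fin 2) ℤ).map (Int.cast : ℤ → ℂ)).transpose =
          c • Ω)
    {A : Matrix (Fin 2 ⊕ Fin 2) (Fin 2 ⊕ Fin 2) ℂ} (hA : A ∈ Matrix.symplecticGroup (Fin 2) ℂ) :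
    ∃ c : ℂ, A * Ω * A.transpose = c • Ω := by
  let X := Matrix.mvPolynomialX (Fin 2 ⊕ Fin 2) (Fin 2 ⊕ Fin 2) ℂ
  let N := X * Ω.map MvPolynomial.C * X.transpose
  have hN : ∀ (M : Matrix (Fin 2 ⊕ Fin 2) (Fin 2 ⊕ Fin 2) ℂ) (i j : Fin 2 ⊕ Fin 2),
      MvPolynomial.eval (fun ij => M ij.1 ij.2) (N i j) = (M * Ω * M.transpose) i j := by
    intro M i j
    simp only [N, X, Matrix.mul_apply, Matrix.transpose_apply, Matrix.map_apply, map_sum, map_mul,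
      Matrix.mvPolynomialX_apply, MvPolynomial.eval_X, MvPolynomial.eval_C]
  -- Proportionality to `Ω` is the vanishing of 2×2 minors, which are polynomials in the entries of
  -- `A`, so it passes from `G` to its Zariski closure.
  have hpoly : ∀ i j k l, (A * Ω * A.transpose) i j * Ω k l =
      (A * Ω * A.transpose) k l * Ω i j := by
    intro i j k l
    have := hG (N i j * MvPolynomial.C (Ω k l) - N k l * MvPolynomial.C (Ω i j)) (fun A hA => ?_)
      A hA
    · simpa only [map_sub, map_mul, MvPolynomial.eval_C, hN, sub_eq_zero] using this
    · obtain ⟨c, hc⟩ := h A hA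
      have h1 := hN ((A : Matrix (Fin 2 ⊕ Fin 2) (Fin 2 ⊕ Fin 2) ℤ).map (Int.cast : ℤ → ℂ))
      simp only [Matrix.map_apply] at h1
      simp only [map_sub, map_mul, MvPolynomial.eval_C, h1, hc, Matrix.smul_apply, smul_eq_mul]
      ring
  have hne : Ω ≠ 0 := by
    rintro rfl
    exact hΩ Matrix.det_zero
  obtain ⟨k, l, hkl⟩ : ∃ k l, Ω k l ≠ 0 := by
    by_contra! hcon
    exact hne (Matrix.ext hcon)
  refine ⟨(A * Ω * A.transpose) k l / Ω k l, ?_⟩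
  ext i j
  rw [Matrix.smul_apply, smul_eq_mul, div_mul_eq_mul_div, eq_div_iff hkl]
  exact hpoly i j k l

theorem SpFourInt.map_mul_J_mul_transpose (A : SpFourInt) :
    (A : Matrix (Fin 2 ⊕ Fin 2) (Fin 2 ⊕ Fin 2) ℤ).map (Int.cast : ℤ → ℂ) * Matrix.J (Fin 2) ℂ *
      ((A : Matrix (Fin 2 ⊕ Fin 2) (Fin 2 ⊕ Fin 2) ℤ).map (Int.cast : ℤ → ℂ)).transpose =
    Matrix.J (Fin 2) ℂ := by
  have h := congrArg (fun M => M.map (Int.castRingHom ℂ)) (SymplecticGroup.mem_iff.1 A.2)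
  simp only [Matrix.map_mul, Matrix.map_J, Matrix.transpose_map] at h
  exact h

/-- If the matrices `A` and `c A`, in possibly different bases, are symplectic, then `A` scales the
form obtained from the standard one by the change of basis by `c⁻²`. -/
theorem sq_smul_mul_transpose_eq {V W : Type*} [AddCommGroup V] [Module ℂ V] [AddCommGroup W]
    [Module ℂ W] (B : Module.Basis (Fin 2 ⊕ Fin 2) ℂ V) (B' : Module.Basis (Fin 2 ⊕ Fin 2) ℂ W)
    (T : V ≃ₗ[ℂ] W) {g : V →ₗ[ℂ] V} {g' : W →ₗ[ℂ] W} {c : ℂ} (h : ∀ y, g' (T y) = c • T (g y))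
    (h' : LinearMap.toMatrix B' B' g' * Matrix.J (Fin 2) ℂ *
      (LinearMap.toMatrix B' B' g').transpose = Matrix.J (Fin 2) ℂ) :
    c ^ 2 • (LinearMap.toMatrix B B g * ((B.map T).toMatrix B' * Matrix.J (Fin 2) ℂ *
      ((B.map T).toMatrix B').transpose) * (LinearMap.toMatrix B B g).transpose) =
    (B.map T).toMatrix B' * Matrix.J (Fin 2) ℂ * ((B.map T).toMatrix B').transpose := by
  set S := (B.map T).toMatrix B'
  set R := B'.toMatrix (B.map T)
  have hSR : S * R = 1 := (B.map T).toMatrix_mul_toMatrix_flip B'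
  have h1 : LinearMap.toMatrix B' B' g' = R * (c • LinearMap.toMatrix B B g) * S := by
    rw [← toMatrix_map_eq_smul B T h]
    exact (basis_toMatrix_mul_linearMap_toMatrix_mul_basis_toMatrix B' (B.map T) B' (B.map T)
      g').symm
  set A := LinearMap.toMatrix B B g
  have h2 : S * (LinearMap.toMatrix B' B' g') = c • (A * S) := by
    rw [h1, ← Matrix.mul_assoc, ← Matrix.mul_assoc, hSR, Matrix.one_mul, Matrix.smul_mul]
  calc c ^ 2 • (A * (S * Matrix.J (Fin 2) ℂ * S.transpose) * A.transpose)
      = (c • (A * S)) * Matrix.J (Fin 2) ℂ * (c • (A * S)).transpose := by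
        simp only [Matrix.transpose_smul, Matrix.transpose_mul, Matrix.smul_mul, Matrix.mul_smul,
          smul_smul, Matrix.mul_assoc, sq]
    _ = S * (LinearMap.toMatrix B' B' g' * Matrix.J (Fin 2) ℂ *
          (LinearMap.toMatrix B' B' g').transpose) * S.transpose := by
        rw [← h2, Matrix.transpose_mul]
        simp only [Matrix.mul_assoc]
    _ = S * Matrix.J (Fin 2) ℂ * S.transpose := by rw [h']

/-! ### The two directions of the theorem -/

namespace ThetaOperator

theorem exists_two_mul_eq_of_isSymplectic {P Q : ThetaOperator} {α : ℂ} (hP : P.IsSymplectic)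
    (hQ : P.shift α = Q) (hQs : Q.IsSymplectic) : ∃ k : ℤ, 2 * α = k := by
  obtain ⟨b, w, hb, hb', hw, g₀, hg₀, g₀', hg₀', h₀⟩ := exists_monodromy_around_zero
    (fun b hb => (hP.2 b hb).elim fun G hG => hG.1.elim fun B _ => ⟨B⟩) hP.1.at_zero hQ
  obtain ⟨G, ⟨B, hB⟩, hG⟩ := hP.2 b hb
  obtain ⟨G', ⟨B', hB'⟩, -⟩ := hQs.2 b hb'
  set T := mulPow hQ hb hw
  set S := (B.map T).toMatrix B'
  set Ω := S * Matrix.J (Fin 2) ℂ * S.transpose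
  have key : ∀ (g : P.solutionSpace b ≃ₗ[ℂ] P.solutionSpace b),
      ∀ g' ∈ Q.monodromyGroup b hb', ∀ c : ℂ, (∀ y, g' (T y) = c • T (g y)) →
      c ^ 2 • (LinearMap.toMatrix B B g.toLinearMap * Ω *
        (LinearMap.toMatrix B B g.toLinearMap).transpose) = Ω := by
    intro g g' hg' c h
    refine sq_smul_mul_transpose_eq B B' T (g := g) (g' := g') h ?_
    obtain ⟨A, -, hA⟩ := hB'.subset ⟨g', hg', rfl⟩
    simp only at hA
    rw [← hA]
    exact SpFourInt.map_mul_J_mul_transpose A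
  have hΩ : Ω.det ≠ 0 := by
    have h1 : S * B'.toMatrix (B.map T) = 1 := (B.map T).toMatrix_mul_toMatrix_flip B'
    have h2 : S.det ≠ 0 := fun h => by
      have := congrArg Matrix.det h1
      rw [Matrix.det_mul, h, zero_mul, Matrix.det_one] at this
      exact zero_ne_one this
    simp only [Ω, Matrix.det_mul, Matrix.det_transpose]
    exact mul_ne_zero (mul_ne_zero h2 (Matrix.isUnit_det_J (Fin 2) ℂ).ne_zero) h2
  have hsc : ∀ A ∈ Matrix.symplecticGroup (Fin 2) ℂ, ∃ c : ℂ, A * Ω * A.transpose = c • Ω := by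
    intro A hA
    refine hG.exists_smul hΩ (fun A hA => ?_) hA
    obtain ⟨g, hg, hgA⟩ := hB.superset ⟨A, hA, rfl⟩
    simp only at hgA
    obtain ⟨n, g', hg', h⟩ := exists_mem_monodromyGroup_shift hQ hb hb' hw hg
    have h1 := key g g' hg' _ h
    rw [hgA] at h1
    refine ⟨(Complex.exp (n * (2 * Real.pi * Complex.I) * α) ^ 2)⁻¹, ?_⟩
    rw [eq_inv_smul_iff₀ (pow_ne_zero 2 (Complex.exp_ne_zero _))]
    exact h1
  obtain ⟨x, hx⟩ := exists_eq_smul_J hΩ hsc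
  obtain ⟨A, -, hA⟩ := hB.subset ⟨g₀, hg₀, rfl⟩
  simp only at hA
  -- For the loop around the origin `Ω` is scaled by `exp (2πiα) ^ 2`; being a multiple of `J`, it
  -- is also fixed by the symplectic matrix of `g₀`.
  have h1 := key g₀ g₀' hg₀' _ h₀
  rw [← hA, hx, Matrix.mul_smul, Matrix.smul_mul, SpFourInt.map_mul_J_mul_transpose A, ← hx] at h1
  have hne : Ω ≠ 0 := by
    intro h
    rw [h] at hΩ
    exact hΩ Matrix.det_zero
  have h2 : Complex.exp (2 * Real.pi * Complex.I * α) ^ 2 = 1 :=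
    smul_left_injective ℂ hne (by simpa using h1)
  rw [← Complex.exp_nat_mul, Complex.exp_eq_one_iff] at h2
  obtain ⟨k, hk⟩ := h2
  refine ⟨k, mul_right_cancel₀ Complex.two_pi_I_ne_zero ?_⟩
  rw [← hk]
  push_cast
  ring

theorem IsSymplectic.shift {P : ThetaOperator} {α : ℂ} {k : ℤ} (hP : P.IsSymplectic)
    (hk : 2 * α = k) : (P.shift α).IsSymplectic := by
  refine ⟨hP.1.shift α, fun b hb' => ?_⟩
  obtain ⟨G, hG, hd⟩ := hP.2 b (notMem_singularSet_of_shift hb')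
  obtain ⟨G', hG', h⟩ := hG.shift hk rfl hb'
  exact ⟨G', hG', hd.of_mem_or_neg_mem h⟩

theorem HasArithmeticMonodromy.shift {P : ThetaOperator} {α : ℂ} {k : ℤ}
    (hP : P.HasArithmeticMonodromy) (hk : 2 * α = k) : (P.shift α).HasArithmeticMonodromy := by
  intro b hb'
  obtain ⟨G, hG, hd⟩ := hP b (notMem_singularSet_of_shift hb')
  obtain ⟨G', hG', h⟩ := hG.shift hk rfl hb'
  exact ⟨G', hG', Subgroup.finiteIndex_of_mem_or_mul_mem _ hd h⟩

end ThetaOperator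

theorem theorem1 (P : ThetaOperator) (hP : P.IsSymplectic) (α : ℂ) :
    ((P.shift α).IsSymplectic ↔ ∃ k : ℤ, 2 * α = k) ∧
      ((∃ k : ℤ, 2 * α = k) →
        (P.HasArithmeticMonodromy ↔ (P.shift α).HasArithmeticMonodromy)) := by
  refine ⟨⟨fun h => ThetaOperator.exists_two_mul_eq_of_isSymplectic hP rfl h,
    fun ⟨k, hk⟩ => hP.shift hk⟩, fun ⟨k, hk⟩ => ⟨fun h => h.shift hk, fun h => ?_⟩⟩
  -- Shifting `P(α)` by `-α` gives back `P`, and `-2α` is again an integer.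
  have h1 := h.shift (α := -α) (k := -k) (by push_cast; rw [← hk]; ring)
  rwa [ThetaOperator.shift_neg_shift] at h1
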